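/- **Theorem (type $C_\ell$, $\ell$ even).** Let $\ell\ge 2$ be even and let $\Phi$ be a (reduced, crystallographic) root system of type $C_\ell$ in a Euclidean space $E$ with inner product $(\cdot,\cdot)$ and Weyl group $W$ (for $\ell=2$, $C_2=B_2$), with simple roots $\alpha_1,\dots,\alpha_\ell$, labelled so that $\alpha_1,\dots,\alpha_\ell$ have the Cartan matrix of type $C_\ell$ with $\alpha_\ell$ the long simple root. Let $Z=\{x\in E : (\alpha,x)\in\mathbb Z \text{ for all } \alpha\in\Phi\}$ be the coweight lattice. For an integer $q>0$ let $M(\Phi;q)$ be the set of classes in $Z/qZ$ of those $x\in Z$ with $(\beta,x)\not\equiv 0 \pmod q$ for all $\beta\in\Phi$, and let $\chi_{\Phi,q}$ be the permutation character of $W$ on $M(\Phi;q)$, i.e. $\chi_{\Phi,q}(w)=\#\{t\in M(\Phi;q): w(t)=t\}$. Let $\omega_\ell=w_\ell w_0$, where $w_0$ is the longest element of $W$ and $w_\ell$ is the longest element of the subgroup generated by the reflections in $\alpha_1,\dots,\alpha_{\ell-1}$. Then for every integer $q>0$: - $\chi_{\Phi,q}(1)=(q-1)(q-3)\cdots(q-(2\ell-1))$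 if $q$ is odd, and $\chi_{\Phi,q}(1)=(q-2)(q-4)\cdots(q-2(\ell-1))\,(q-\ell)$ if $q$ is even; - $\chi_{\Phi,q}(\omega_\ell)=0$ if $\gcd(4,q)=1$; - $\chi_{\Phi,q}(\omega_\ell)=(q-2)(q-6)\cdots(q-2(\ell-1))$ if $\gcd(4,q)=2$; - $\chi_{\Phi,q}(\omega_\ell)=(q-4)(q-8)\cdots(q-2(\ell-2))\,(q-\ell)$ if $\gcd(4,q)=4$. Moreover, write $\omega=\omega_\ell$, $E^{\omega}=\{x\in E:\omega(x)=x\}$, $x^\omega=\frac1{o(\omega)}\sum_{t=1}^{o(\omega)}\omega^t(x)$ with $o(\omega)$ the order of $\omega$, and $\Phi_{\mathrm{re}}^\omega=\{\beta^\omega:\beta\in\Phi,\ \beta^\omega\ne0\}\subset E^\omega$. Then $o(\omega)=2$, $\Phi_{\mathrm{re}}^\omega$ is a root system of type $C_{\ell/2}$ in $E^\omega$ (where $C_1=A_1$), and, with $M$ the coweight lattice of $\Phi_{\mathrm{re}}^\omega$ in $E^\omega$, $$\chi_{\Phi,q}(\omega)=c(q)\cdot\#\{\bar x\in M/qM : (2\beta,x)\not\equiv0\pmod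 q\text{ for all }\beta\in\Phi_{\mathrm{re}}^\omega\},$$ where $c(q)=\varphi(o(\omega))=1$ if $o(\omega)=2$ divides $q$, and $c(q)=0$ otherwise. -/

import Mathlib

open scoped RealInnerProductSpace

noncomputable section

namespace EquivQuasi

/-! ### Longest elements -/

/-- The length of `w` with respect to a generating set `S` of involutions: the least length of a
word in elements of `S` whose product is `w`. -/
def wordLength {G : Type*} [Group G] (S : Set G) (w : G) : ℕ :=
  sInf {n | ∃ l : List G, (∀ s ∈ l, s ∈ S) ∧ l.prod = w ∧ l.length = n}

/-- `w` is an element of maximal length in the subgroup generated by `S`. -/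
def IsLongest {G : Type*} [Group G] (S : Set G) (w : G) : Prop :=
  w ∈ Subgroup.closure S ∧ ∀ v ∈ Subgroup.closure S, wordLength S v ≤ wordLength S w

/-- The longest element of the group generated by `S`. -/
def longestElement {G : Type*} [Group G] (S : Set G) : G :=
  Classical.epsilon (IsLongest S)

/-! ### Lattices and complements modulo `q` -/

section Lattices

variable {V : Type*} [NormedAddCommGroup V] [InnerProductSpace ℝ V]

/-- The coweight lattice of a set of vectors `Φ`: all `x` with `(α, x) ∈ ℤ` for every `α ∈ Φ`. -/
def coweightLattice (Φ : Set V) : AddSubgroup V where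
  carrier := {x | ∀ α ∈ Φ, ∃ n : ℤ, ⟪α, x⟫ = n}
  zero_mem' := fun _ _ => ⟨0, by simp⟩
  add_mem' := by
    intro x y hx hy α hα
    obtain ⟨m, hm⟩ := hx α hα
    obtain ⟨n, hn⟩ := hy α hα
    exact ⟨m + n, by rw [inner_add_right, hm, hn]; push_cast; rfl⟩
  neg_mem' := by
    intro x hx α hα
    obtain ⟨m, hm⟩ := hx α hα
    exact ⟨-m, by rw [inner_neg_right, hm]; push_cast; rfl⟩

/-- The subgroup `q A` of an abelian group `A`. -/
def multiples (A : Type*) [AddCommGroup A] (q : ℕ) : AddSubgroup A :=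
  (nsmulAddMonoidHom (α := A) q).range

/-- The quotient `A / q A`. -/
abbrev ModQ (A : Type*) [AddCommGroup A] (q : ℕ) : Type _ := A ⧸ multiples A q

/-- The complement `M(Φ, L; q)`: the classes in `L / q L` of those `x ∈ L` such that
`(β, x) ≢ 0 (mod q)` for all `β ∈ Φ`. -/
def modComplement (Φ : Set V) (L : AddSubgroup V) (q : ℕ) : Set (ModQ L q) :=
  (fun x : L => (QuotientAddGroup.mk x : ModQ L q)) ''
    {x : L | ∀ β ∈ Φ, ∀ k : ℤ, ⟪β, (x : V)⟫ ≠ (q : ℝ) * k}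

/-- The characteristic quasi-polynomial of `Φ` with respect to the lattice `L`, evaluated
at `q`. -/
def charQuasi (Φ : Set V) (L : AddSubgroup V) (q : ℕ) : ℕ :=
  Nat.card (modComplement Φ L q)

/-- The dilation `d Φ`. -/
def dilate (d : ℝ) (Φ : Set V) : Set V := (fun β => d • β) '' Φ

/-- A root pairing of a real inner product space with itself which is a root system in the
Euclidean sense: the pairing is the inner product and the coroot of a root `α` is
`2 α / (α, α)`. -/
class IsEuclidean {ι : Type*} (P : RootPairing ι ℝ V V) : Prop where
  pairing_eq : ∀ x y : V, P.toLinearMap x y = ⟪x, y⟫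
  coroot_eq : ∀ i, P.coroot i = (2 / ⟪P.root i, P.root i⟫) • P.root i

/-- The enumeration `α_1, …, α_n` (indexed by `Fin n`) of the simple roots of the base `b` has
the Cartan matrix of type `C_n` (so for `n ≥ 2` the last simple root is the long one). -/
def IsTypeCLabelling {ι : Type*} {P : RootPairing ι ℝ V V} [P.IsCrystallographic] (b : P.Base)
    {n : ℕ} (e : Fin n ≃ b.support) : Prop :=
  ∀ i j, b.cartanMatrix (e i) (e j) = CartanMatrix.C n i j

/-- The set `Φ ⊆ V` is a (reduced, crystallographic) root system of type `C_n` in the Euclidean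
space `V`. -/
def IsRootSystemOfTypeC (n : ℕ) (Φ : Set V) : Prop :=
  Φ.Finite ∧ ∃ P : RootPairing Φ ℝ V V, (∀ β : Φ, P.root β = β) ∧
    IsEuclidean P ∧ P.IsRootSystem ∧ P.IsReduced ∧
    ∃ _ : P.IsCrystallographic, ∃ b : P.Base, ∃ e : Fin n ≃ b.support, IsTypeCLabelling b e

end Lattices

/-! ### The Weyl group and its permutation character -/

section Weyl

variable {ι E : Type*} [NormedAddCommGroup E] [InnerProductSpace ℝ E]

/-- The coweight lattice `Z` of a Euclidean root system. -/
abbrev latticeZ (P : RootPairing ι ℝ E E) : AddSubgroup E := coweightLattice (Set.range P.root)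

lemma inner_weyl_smul (P : RootPairing ι ℝ E E) [IsEuclidean P] (w : P.weylGroup) (x y : E) :
    ⟪w • x, w • y⟫ = ⟪x, y⟫ := by
  revert x y
  obtain ⟨w, hw⟩ := w
  induction hw using RootPairing.weylGroup.induction with
  | mem i =>
    intro x y
    change ⟪P.reflection i x, P.reflection i y⟫ = ⟪x, y⟫
    have h0 : ⟪P.root i, P.root i⟫ ≠ 0 := by
      simpa using P.ne_zero i
    have hc : ∀ z, P.coroot' i z = 2 / ⟪P.root i, P.root i⟫ * ⟪P.root i, z⟫ := by
      intro z
      change P.toLinearMap z (P.coroot i) = _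
      rw [IsEuclidean.pairing_eq, IsEuclidean.coroot_eq, inner_smul_right,
        real_inner_comm z]
    rw [P.reflection_apply, P.reflection_apply, hc, hc]
    simp only [inner_sub_left, inner_sub_right, inner_smul_left, inner_smul_right,
      real_inner_comm (P.root i) x, RCLike.conj_to_real]
    field_simp
    ring
  | one => intro x y; rfl
  | mul g₁ g₂ hg₁ hg₂ h₁ h₂ =>
    intro x y
    exact (h₁ _ _).trans (h₂ x y)

lemma weyl_smul_mem (P : RootPairing ι ℝ E E) [IsEuclidean P] (w : P.weylGroup) {x : E}
    (hx : x ∈ latticeZ P) : w • x ∈ latticeZ P := by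
  rintro _ ⟨i, rfl⟩
  obtain ⟨n, hn⟩ := hx _ ⟨P.weylGroupToPerm w⁻¹ i, rfl⟩
  refine ⟨n, ?_⟩
  rw [← hn, ← P.weylGroup_apply_root, ← inner_weyl_smul P w (w⁻¹ • P.root i), smul_inv_smul]

/-- The action of a Weyl group element on the coweight lattice. -/
def weylHom (P : RootPairing ι ℝ E E) [IsEuclidean P] (w : P.weylGroup) :
    latticeZ P →+ latticeZ P where
  toFun x := ⟨w • (x : E), weyl_smul_mem P w x.2⟩
  map_zero' := Subtype.ext (smul_zero w)
  map_add' x y := Subtype.ext (smul_add w (x : E) (y : E))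

lemma multiples_le_comap {A : Type*} [AddCommGroup A] (f : A →+ A) (q : ℕ) :
    multiples A q ≤ (multiples A q).comap f := by
  rintro _ ⟨x, rfl⟩
  exact ⟨f x, by simp⟩

/-- The action `π_q(x) ↦ π_q(w x)` of the Weyl group on `Z / q Z`. -/
instance weylActionModQ (P : RootPairing ι ℝ E E) [IsEuclidean P] (q : ℕ) :
    MulAction P.weylGroup (ModQ (latticeZ P) q) where
  smul w := QuotientAddGroup.map _ _ (weylHom P w) (multiples_le_comap _ q)
  one_smul t := by
    induction t using QuotientAddGroup.induction_on with
    | H x => exact congrArg QuotientAddGroup.mk (Subtype.ext (one_smul P.weylGroup (x : E)))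
  mul_smul v w t := by
    induction t using QuotientAddGroup.induction_on with
    | H x => exact congrArg QuotientAddGroup.mk (Subtype.ext (mul_smul v w (x : E)))

lemma smul_mk (P : RootPairing ι ℝ E E) [IsEuclidean P] (q : ℕ) (w : P.weylGroup)
    (x : latticeZ P) :
    w • (QuotientAddGroup.mk x : ModQ (latticeZ P) q) = QuotientAddGroup.mk (weylHom P w x) :=
  rfl

/-- The complement `M(Φ; q)` in `Z / q Z`. -/
abbrev complement (P : RootPairing ι ℝ E E) (q : ℕ) : Set (ModQ (latticeZ P) q) :=
  modComplement (Set.range P.root) (latticeZ P) q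

lemma smul_mem_complement (P : RootPairing ι ℝ E E) [IsEuclidean P] (q : ℕ) (w : P.weylGroup)
    {t : ModQ (latticeZ P) q} (ht : t ∈ complement P q) : w • t ∈ complement P q := by
  obtain ⟨x, hx, rfl⟩ := ht
  refine ⟨weylHom P w x, ?_, rfl⟩
  rintro _ ⟨i, rfl⟩ k
  have h := hx _ ⟨P.weylGroupToPerm w⁻¹ i, rfl⟩ k
  rw [← P.weylGroup_apply_root, ← inner_weyl_smul P w (w⁻¹ • P.root i), smul_inv_smul] at h
  exact h

/-- The action of the Weyl group on `M(Φ; q)`. -/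
instance weylActionComplement (P : RootPairing ι ℝ E E) [IsEuclidean P] (q : ℕ) :
    MulAction P.weylGroup (complement P q) where
  smul w t := ⟨w • (t : ModQ (latticeZ P) q), smul_mem_complement P q w t.2⟩
  one_smul t := Subtype.ext (one_smul P.weylGroup (t : ModQ (latticeZ P) q))
  mul_smul v w t := Subtype.ext (mul_smul v w (t : ModQ (latticeZ P) q))

/-- The equivariant characteristic quasi-polynomial `χ_{Φ,q}`: the permutation character of the
Weyl group on `M(Φ; q)`, that is, `w ↦ #{t ∈ M(Φ; q) | w t = t}`. -/
def equivChar (P : RootPairing ι ℝ E E) [IsEuclidean P] (q : ℕ) (w : P.weylGroup) : ℕ :=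
  Nat.card (MulAction.fixedBy (complement P q) w)

/-- The reflections in the simple roots `α_i`, `i ∈ I`. -/
def simpleReflections {P : RootPairing ι ℝ E E} (I : Set ι) : Set P.weylGroup :=
  RootPairing.weylGroup.ofIdx P '' I

/-- `ω_j = w_j w_0`, where `w_0` is the longest element of the Weyl group and `w_j` is the longest
element of the Weyl group generated by the reflections in the simple roots other than `α_j`. -/
def omega {P : RootPairing ι ℝ E E} (b : P.Base) (j : b.support) : P.weylGroup :=
  longestElement (simpleReflections ((b.support : Set ι) \ {(j : ι)})) *
    longestElement (simpleReflections (b.support : Set ι))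

/-! ### Folding -/

/-- The space `E^w` of vectors fixed by `w`. -/
def fixedSpace {P : RootPairing ι ℝ E E} (w : P.weylGroup) : Submodule ℝ E where
  carrier := {x | w • x = x}
  zero_mem' := smul_zero w
  add_mem' := by
    intro x y hx hy
    change w • (x + y) = x + y
    rw [smul_add, hx, hy]
  smul_mem' := by
    intro c x hx
    change w • (c • x) = c • x
    rw [smul_comm, hx]

/-- The average `x^w = o(w)⁻¹ ∑_{t = 1}^{o(w)} w^t x`, where `o(w)` is the order of `w`. -/
def average {P : RootPairing ι ℝ E E} (w : P.weylGroup) (x : E) : E :=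
  (orderOf w : ℝ)⁻¹ • ∑ t ∈ Finset.Icc 1 (orderOf w), w ^ t • x

/-- The set `{β^w | β ∈ Φ, β^w ≠ 0}`, as a subset of the Euclidean space `E^w`. -/
def foldedRoots (P : RootPairing ι ℝ E E) (w : P.weylGroup) : Set (fixedSpace w) :=
  {v | v ≠ 0 ∧ ∃ i, average w (P.root i) = v}

end Weyl

end EquivQuasi

end

/-!
A root system of type `C_l` consists of the vectors `± ε_i ± ε_j` and `± 2 ε_i` for an orthogonal
basis `ε` of vectors of equal length. The doubled coordinates of a coweight are integers of equal
parity, and modulo `q` they are determined modulo `2 q` up to adding `q` to all of them at once. So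
twice the number of admissible classes is the number of tuples of residues modulo `2 q` of equal
parity that avoid the roots, and these are counted by choosing their entries in turn, distinct up to
sign.

Since word length is the number of inversions, `w_0 = -1` and `w_l` reverses the order of
`ε_1, …, ε_l`, whence `ω ε_i = -ε_{l + 1 - i}` and `ω` has order two. An admissible class is fixed
by `ω` exactly when its coordinates satisfy `f_i + f_{l + 1 - i} = q`. The parities rule this out
for odd `q`; for even `q` such tuples correspond to their first halves, which are exactly the tuples
of length `l / 2` that avoid twice the roots of type `C_{l / 2}`. The vectors
`(ε_i - ε_{l + 1 - i}) / 2` with `i ≤ l / 2` are the orthogonal basis that exhibits the folded roots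
as being of that type.
-/

noncomputable section

namespace EquivQuasi

/-! ### Counting tuples -/

section Counting

open Finset

variable {α β κ : Type*}

/-- Tuples with injective image, grouped by their image. -/
def injectiveCompEquiv (π : α → β) :
    {f : κ → α // Function.Injective (π ∘ f)} ≃ Σ g : κ ↪ β, ∀ i, {x // π x = g i} where
  toFun f := ⟨⟨π ∘ f, f.2⟩, fun i => ⟨f.1 i, rfl⟩⟩
  invFun p := ⟨fun i => p.2 i, by
    rw [show (π ∘ fun i => (p.2 i : α)) = p.1 from funext fun i => (p.2 i).2]
    exact p.1.injective⟩
  left_inv _ := rfl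
  right_inv := by
    rintro ⟨⟨g, hg⟩, x⟩
    obtain ⟨f, hf, rfl⟩ : ∃ (f : κ → α) (hf : ∀ i, π (f i) = g i), x = fun i => ⟨f i, hf i⟩ :=
      ⟨fun i => x i, fun i => (x i).2, rfl⟩
    obtain rfl : π ∘ f = g := funext hf
    rfl

lemma natCard_eq_mul_natCard_of_surjective [Finite α] {π : α → β} (hπ : Function.Surjective π)
    {D : ℕ} (hD : ∀ y, Nat.card {x // π x = y} = D) : Nat.card α = D * Nat.card β := by
  have := Finite.of_surjective π hπ
  have := Fintype.ofFinite β
  rw [Nat.card_congr (Equiv.sigmaFiberEquiv π).symm, Nat.card_sigma]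
  simp only [hD, sum_const, card_univ, Nat.card_eq_fintype_card, smul_eq_mul, mul_comm]

lemma natCard_injective_comp_of_surjective [Finite α] [Finite κ] {π : α → β}
    (hπ : Function.Surjective π) {D : ℕ} (hD : ∀ y, Nat.card {x // π x = y} = D) :
    (Nat.card {f : κ → α // Function.Injective (π ∘ f)} : ℤ) =
      ∏ k ∈ range (Nat.card κ), ((Nat.card α : ℤ) - D * k) := by
  have := Fintype.ofFinite κ
  have := Finite.of_surjective π hπ
  have := Fintype.ofFinite β
  have hα := natCard_eq_mul_natCard_of_surjective hπ hD
  have hprod : ∏ k ∈ range (Nat.card κ), ((Nat.card α : ℤ) - D * k) =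
      D ^ Nat.card κ * ∏ k ∈ range (Nat.card κ), ((Nat.card β : ℤ) - k) := by
    rw [prod_congr rfl (g := fun k : ℕ => (D : ℤ) * ((Nat.card β : ℤ) - k)) fun k _ => by
      rw [hα]; push_cast; ring, prod_mul_distrib, prod_const, card_range]
  rw [hprod, ← descPochhammer_eval_eq_prod_range, descPochhammer_eval_eq_descFactorial,
    Nat.card_congr (injectiveCompEquiv π), Nat.card_sigma]
  simp [Nat.card_pi, hD, Fintype.card_embedding_eq, mul_comm]

lemma natCard_injective_comp [Finite α] [Finite κ] {π : α → β} {D : ℕ}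
    (hD : ∀ x, Nat.card {y // π y = π x} = D) :
    (Nat.card {f : κ → α // Function.Injective (π ∘ f)} : ℤ) =
      ∏ k ∈ range (Nat.card κ), ((Nat.card α : ℤ) - D * k) := by
  rw [← natCard_injective_comp_of_surjective (Set.rangeFactorization_surjective (f := π)) (D := D)]
  · simp only [Function.Injective, Function.comp_apply, Set.rangeFactorization, Subtype.mk.injEq]
  · rintro ⟨_, x, rfl⟩
    exact (Nat.card_congr (Equiv.subtypeEquivRight fun y => Subtype.ext_iff)).trans (hD x)

lemma two_mul_natCard_fiber {G : Type*} [AddGroup G] [Finite G] {φ : G →+ ZMod 2}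
    (hφ : Function.Surjective φ) (p : ZMod 2) : 2 * Nat.card {g // φ g = p} = Nat.card G := by
  classical
  have := Fintype.ofFinite G
  have hconst : ∀ p', Nat.card {g // φ g = p'} = Nat.card {g // φ g = p} := fun p' => by
    simpa [Fintype.card_subtype] using
      AddMonoidHom.card_fiber_eq_of_mem_range φ (hφ p') (hφ p)
  rw [natCard_eq_mul_natCard_of_surjective hφ hconst, Nat.card_zmod, mul_comm]

end Counting

/-! ### Residues modulo `2 q` -/

section Residues

open Finset

variable {q d s : ℕ}

/-- The parity of a residue modulo `2 q`. -/
def parity (q : ℕ) : ZMod (2 * q) →+* ZMod 2 := ZMod.castHom (dvd_mul_right 2 q) _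

lemma parity_eq_zero [NeZero q] {m r : ℕ} (h : 2 * q = m * r) (hr : Even r) {u : ZMod (2 * q)}
    (hu : (m : ZMod (2 * q)) * u = 0) : parity q u = 0 := by
  rw [← ZMod.natCast_zmod_val u, ← Nat.cast_mul, ZMod.natCast_eq_zero_iff] at hu
  nth_rw 1 [h] at hu
  have hm : 0 < m := Nat.pos_of_mul_pos_right (h ▸ Nat.pos_of_neZero (2 * q))
  rw [← ZMod.natCast_zmod_val u, map_natCast, ZMod.natCast_eq_zero_iff]
  exact hr.two_dvd.trans (Nat.dvd_of_mul_dvd_mul_left hm hu)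

lemma natCard_mul_eq_zero (n m : ℕ) [NeZero n] :
    Nat.card {u : ZMod n // (m : ZMod n) * u = 0} = n.gcd m := by
  have := IsAddCyclic.card_nsmulAddMonoidHom_ker (G := ZMod n) m
  rw [Nat.card_zmod] at this
  rw [← this]
  exact Nat.card_congr (Equiv.subtypeEquivRight fun u => by simp)

lemma natCard_parity_eq [NeZero q] (p : ZMod 2) : Nat.card {u // parity q u = p} = q := by
  have := two_mul_natCard_fiber (φ := (parity q).toAddMonoidHom)
    (ZMod.castHom_surjective (dvd_mul_right 2 q)) p
  rw [Nat.card_zmod] at this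
  exact mul_left_cancel₀ two_ne_zero this

lemma natCard_parity_eq_and_mul_eq_zero_of_odd [NeZero q] (hq : q = d * s) (hs : Odd s)
    (p : ZMod 2) :
    Nat.card {u : ZMod (2 * q) // parity q u = p ∧ (d : ZMod (2 * q)) * (2 * u) = 0} = d := by
  let K := (nsmulAddMonoidHom (α := ZMod (2 * q)) (2 * d)).ker
  have hK : ∀ u, u ∈ K ↔ (d : ZMod (2 * q)) * (2 * u) = 0 := fun u => by
    simp [K, mul_assoc, mul_left_comm]
  have hcard : Nat.card K = 2 * d := by
    rw [IsAddCyclic.card_nsmulAddMonoidHom_ker, Nat.card_zmod, hq, ← mul_assoc]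
    exact Nat.gcd_eq_right (dvd_mul_right _ _)
  have hsurj : Function.Surjective ((parity q).toAddMonoidHom.comp K.subtype) := fun p => by
    refine ⟨⟨s * p.val, (hK _).2 ?_⟩, ?_⟩
    · have hq0 : (d : ZMod (2 * q)) * (2 * s) = 0 := by
        exact_mod_cast (congrArg Nat.cast (show d * (2 * s) = 2 * q by rw [hq]; ring)).trans
          (ZMod.natCast_self (2 * q))
      linear_combination (p.val : ZMod (2 * q)) * hq0
    · change parity q (s * p.val) = p
      rw [map_mul, map_natCast, map_natCast, ZMod.natCast_eq_one_iff_odd.2 hs, one_mul,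
        ZMod.natCast_zmod_val]
  have := two_mul_natCard_fiber hsurj p
  rw [hcard] at this
  refine Eq.trans ?_ (mul_left_cancel₀ two_ne_zero this)
  exact Nat.card_congr (Equiv.trans (Equiv.subtypeEquivRight fun u => by rw [← hK, and_comm])
    (Equiv.subtypeSubtypeEquivSubtypeInter (· ∈ K) (parity q · = p)).symm)

lemma natCard_parity_eq_and_mul_eq_zero_of_even [NeZero q] (hq : q = d * s) (hs : Even s)
    (p : ZMod 2) :
    Nat.card {u : ZMod (2 * q) // parity q u = p ∧ (d : ZMod (2 * q)) * (2 * u) = 0} =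
      if p = 0 then 2 * d else 0 := by
  have hpar : ∀ u : ZMod (2 * q), (d : ZMod (2 * q)) * (2 * u) = 0 → parity q u = 0 :=
    fun u hu => parity_eq_zero (m := 2 * d) (r := s) (by rw [hq, mul_assoc]) hs
      (by push_cast; linear_combination hu)
  split_ifs with hp
  · have := natCard_mul_eq_zero (2 * q) (2 * d)
    rw [Nat.gcd_eq_right (mul_dvd_mul_left 2 ⟨s, hq⟩)] at this
    rw [← this]
    refine Nat.card_congr (Equiv.subtypeEquivRight fun u => ?_)
    rw [hp, and_iff_right_of_imp (hpar u)]
    push_cast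
    rw [mul_assoc, mul_left_comm]
  · have : IsEmpty {u // parity q u = p ∧ (d : ZMod (2 * q)) * (2 * u) = 0} :=
      ⟨fun u => hp (u.2.1.symm.trans (hpar u u.2.2))⟩
    exact Nat.card_of_isEmpty

end Residues

section AvoidingTuples

open Finset

variable {q d s : ℕ} {κ : Type*}

/-- The condition on a tuple of residues modulo `2 q` expressing that `d` times a root of type `C`,
one of `± 2 ε_i` and `± ε_i ± ε_j` in coordinates, does not vanish modulo `q`. The modulus is
`2 q` because the coordinates are doubled, so as to be integral on the coweight lattice. -/
def AvoidsRoots (q d : ℕ) (f : κ → ZMod (2 * q)) : Prop :=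
  (∀ i, (d : ZMod (2 * q)) * (2 * f i) ≠ 0) ∧
    ∀ i j, i ≠ j → (d : ZMod (2 * q)) * (f i + f j) ≠ 0 ∧ (d : ZMod (2 * q)) * (f i - f j) ≠ 0

/-- The tuples of residues modulo `2 q` of equal parities which avoid the roots dilated by `d`. -/
def avoidingTuples (q d : ℕ) (κ : Type*) : Set (κ → ZMod (2 * q)) :=
  {f | (∀ i j, parity q (f i) = parity q (f j)) ∧ AvoidsRoots q d f}

/-- The residues modulo `2 q` of parity `p` which avoid the long roots dilated by `d`. -/
def avoidingResidues (q d : ℕ) (p : ZMod 2) : Set (ZMod (2 * q)) :=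
  {u | parity q u = p ∧ (d : ZMod (2 * q)) * (2 * u) ≠ 0}

/-- The multiple `d u` up to sign. Avoiding the short roots means that these are distinct for the
entries of a tuple. -/
def mulUpToSign (q d : ℕ) (u : ZMod (2 * q)) : Sym2 (ZMod (2 * q)) := s(d * u, -(d * u))

lemma mulUpToSign_eq_iff {u v : ZMod (2 * q)} : mulUpToSign q d u = mulUpToSign q d v ↔
    (d : ZMod (2 * q)) * (u + v) = 0 ∨ (d : ZMod (2 * q)) * (u - v) = 0 := by
  rw [mulUpToSign, mulUpToSign, Sym2.eq_iff, neg_inj, neg_eq_iff_eq_neg, and_self, and_self,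
    or_comm, mul_add, mul_sub, sub_eq_zero, ← eq_neg_iff_add_eq_zero]

lemma natCard_avoidingResidues [NeZero q] (p : ZMod 2) :
    (Nat.card (avoidingResidues q d p) : ℤ) =
      q - Nat.card {u // parity q u = p ∧ (d : ZMod (2 * q)) * (2 * u) = 0} := by
  have hdiff : avoidingResidues q d p =
      {u | parity q u = p} \ {u | parity q u = p ∧ (d : ZMod (2 * q)) * (2 * u) = 0} := by
    ext u
    simp only [avoidingResidues, Set.mem_sdiff, Set.mem_ofPred_eq]
    tauto
  have hcard := Set.ncard_sdiff_add_ncard_of_subset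
    (s := {u | parity q u = p ∧ (d : ZMod (2 * q)) * (2 * u) = 0}) (t := {u | parity q u = p})
    fun _ hu => hu.1
  rw [← hdiff, ← Nat.card_coe_set_eq, ← Nat.card_coe_set_eq, ← Nat.card_coe_set_eq,
    Set.coe_ofPred, Set.coe_ofPred, natCard_parity_eq] at hcard
  lia

lemma parity_eq_zero_of_mul_eq_zero [NeZero q] (hd : d ∣ q) {u : ZMod (2 * q)}
    (hu : (d : ZMod (2 * q)) * u = 0) : parity q u = 0 := by
  obtain ⟨s, hs⟩ := hd
  exact parity_eq_zero (r := 2 * s) (by rw [hs, mul_left_comm]) (even_two_mul s) hu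

lemma mem_avoidingResidues_of_mulUpToSign_eq [NeZero q] (hd : d ∣ q) {p : ZMod 2}
    {u v : ZMod (2 * q)} (hu : u ∈ avoidingResidues q d p)
    (huv : mulUpToSign q d v = mulUpToSign q d u) : v ∈ avoidingResidues q d p := by
  obtain ⟨hup, hu0⟩ := hu
  rcases mulUpToSign_eq_iff.1 huv with h | h
  · have hpar := parity_eq_zero_of_mul_eq_zero hd h
    rw [map_add, hup, CharTwo.add_eq_zero] at hpar
    exact ⟨hpar, fun hv => hu0 (by linear_combination 2 * h - hv)⟩
  · have hpar := parity_eq_zero_of_mul_eq_zero hd h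
    rw [map_sub, hup, sub_eq_zero] at hpar
    exact ⟨hpar, fun hv => hu0 (by linear_combination hv - 2 * h)⟩

lemma natCard_mulUpToSign_fiber [NeZero q] (hd : d ∣ q) {p : ZMod 2} (u : avoidingResidues q d p) :
    Nat.card {v : avoidingResidues q d p // mulUpToSign q d v = mulUpToSign q d u} = 2 * d := by
  let T (w : ZMod (2 * q)) : Set (ZMod (2 * q)) := {v | (d : ZMod (2 * q)) * (v - w) = 0}
  have hT : ∀ w, (T w).ncard = d := fun w => by
    rw [← Nat.card_coe_set_eq, ← Nat.gcd_eq_right (hd.mul_left 2), ← natCard_mul_eq_zero]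
    exact Nat.card_congr ((Equiv.subRight w).subtypeEquiv fun v => Iff.rfl)
  have hdisj : Disjoint (T (-u)) (T u) := Set.disjoint_left.2 fun v h h' => u.2.2 (by
    simp only [T, Set.mem_ofPred_eq] at h h'
    linear_combination h - h')
  have hiff : ∀ v, mulUpToSign q d v = mulUpToSign q d u ↔ v ∈ T (-u) ∪ T u := fun v => by
    simp only [mulUpToSign_eq_iff, T, Set.mem_union, Set.mem_ofPred_eq, sub_neg_eq_add]
  have hunion : Nat.card (T (-u) ∪ T u : Set (ZMod (2 * q))) = 2 * d := by
    rw [Nat.card_coe_set_eq, Set.ncard_union_eq hdisj, hT, hT, two_mul]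
  rw [← hunion]
  refine Nat.card_congr ((Equiv.subtypeSubtypeEquivSubtype fun {v} hv => ?_).trans
    (Equiv.subtypeEquivRight hiff))
  exact mem_avoidingResidues_of_mulUpToSign_eq hd u.2 hv

lemma avoidsRoots_iff_injective {f : κ → ZMod (2 * q)} : AvoidsRoots q d f ↔
    (∀ i, (d : ZMod (2 * q)) * (2 * f i) ≠ 0) ∧ Function.Injective (mulUpToSign q d ∘ f) := by
  refine and_congr_right fun _ => ?_
  rw [Function.injective_iff_pairwise_ne]
  refine forall₃_congr fun i j _ => ?_
  simp only [Function.onFun, Function.comp_apply, ne_eq, mulUpToSign_eq_iff, not_or]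

/-- The avoiding tuples whose entries all have parity `p`. -/
def avoidingTuplesParityEquiv (i₀ : κ) (p : ZMod 2) :
    {f : avoidingTuples q d κ // parity q (f.1 i₀) = p} ≃
      {f : κ → avoidingResidues q d p //
        Function.Injective ((fun u => mulUpToSign q d u.1) ∘ f)} where
  toFun f := ⟨fun i => ⟨f.1.1 i, (f.1.2.1 i i₀).trans f.2, f.1.2.2.1 i⟩,
    (avoidsRoots_iff_injective.1 f.1.2.2).2⟩
  invFun f := ⟨⟨fun i => f.1 i, fun i j => (f.1 i).2.1.trans (f.1 j).2.1.symm,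
    avoidsRoots_iff_injective.2 ⟨fun i => (f.1 i).2.2, f.2⟩⟩, (f.1 i₀).2.1⟩
  left_inv _ := rfl
  right_inv _ := rfl

lemma natCard_avoidingTuples [NeZero q] [Finite κ] [Nonempty κ] (hd : d ∣ q) :
    (Nat.card (avoidingTuples q d κ) : ℤ) =
      ∏ k ∈ range (Nat.card κ), ((Nat.card (avoidingResidues q d 0) : ℤ) - (2 * d : ℕ) * k) +
      ∏ k ∈ range (Nat.card κ), ((Nat.card (avoidingResidues q d 1) : ℤ) - (2 * d : ℕ) * k) := by
  obtain ⟨i₀⟩ := ‹Nonempty κ›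
  rw [← natCard_injective_comp (natCard_mulUpToSign_fiber hd),
    ← natCard_injective_comp (natCard_mulUpToSign_fiber hd),
    ← Nat.card_congr (avoidingTuplesParityEquiv i₀ 0),
    ← Nat.card_congr (avoidingTuplesParityEquiv i₀ 1),
    Nat.card_congr (Equiv.sigmaFiberEquiv fun f : avoidingTuples q d κ => parity q (f.1 i₀)).symm,
    Nat.card_sigma]
  exact_mod_cast Fin.sum_univ_two _

lemma natCard_avoidingTuples_of_odd [Finite κ] [Nonempty κ] (hq : q = d * s) (hd : 0 < d)
    (hs : Odd s) : (Nat.card (avoidingTuples q d κ) : ℤ) =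
      2 * ∏ k ∈ Icc 1 (Nat.card κ), ((q : ℤ) - d * (2 * k - 1)) := by
  have : NeZero q := ⟨hq ▸ (Nat.mul_pos hd hs.pos).ne'⟩
  rw [natCard_avoidingTuples ⟨s, hq⟩, natCard_avoidingResidues, natCard_avoidingResidues,
    natCard_parity_eq_and_mul_eq_zero_of_odd hq hs, natCard_parity_eq_and_mul_eq_zero_of_odd hq hs,
    ← two_mul, ← Ico_add_one_right_eq_Icc, prod_Ico_eq_prod_range, Nat.add_sub_cancel]
  refine congrArg (2 * ·) (prod_congr rfl fun k _ => ?_)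
  push_cast
  ring

lemma natCard_avoidingTuples_of_even [Finite κ] [Nonempty κ] (hq : q = d * s) (hq0 : 0 < q)
    (hs : Even s) : (Nat.card (avoidingTuples q d κ) : ℤ) =
      2 * ((∏ k ∈ Icc 1 (Nat.card κ - 1), ((q : ℤ) - 2 * d * k)) * (q - d * Nat.card κ)) := by
  have : NeZero q := ⟨hq0.ne'⟩
  obtain ⟨n, hn⟩ := Nat.exists_eq_add_of_lt (Nat.card_pos (α := κ))
  have hshift : ∏ k ∈ Icc 1 n, ((q : ℤ) - 2 * d * k) =
      ∏ k ∈ range n, ((q : ℤ) - (2 * d : ℕ) * (k + 1 : ℕ)) := by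
    rw [← Ico_add_one_right_eq_Icc, prod_Ico_eq_prod_range, Nat.add_sub_cancel]
    exact prod_congr rfl fun k _ => by push_cast; ring
  have hzero : ∏ k ∈ range n, ((q : ℤ) - (2 * d : ℕ) - (2 * d : ℕ) * k) =
      ∏ k ∈ range n, ((q : ℤ) - (2 * d : ℕ) * (k + 1 : ℕ)) :=
    prod_congr rfl fun k _ => by push_cast; ring
  rw [natCard_avoidingTuples ⟨s, hq⟩, natCard_avoidingResidues, natCard_avoidingResidues,
    natCard_parity_eq_and_mul_eq_zero_of_even hq hs, if_pos rfl,
    natCard_parity_eq_and_mul_eq_zero_of_even hq hs, if_neg one_ne_zero, hn, zero_add,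
    Nat.add_sub_cancel, hshift, prod_range_succ, hzero, prod_range_succ',
    Nat.cast_zero, sub_zero]
  push_cast
  ring

end AvoidingTuples

/-! ### Classes of coweights -/

section Classes

variable {V : Type*} [NormedAddCommGroup V] [InnerProductSpace ℝ V] {Φ : Set V} {q : ℕ}

lemma mk_mem_modComplement_iff {L : AddSubgroup V} (hL : L ≤ coweightLattice Φ) {x : L} :
    QuotientAddGroup.mk x ∈ modComplement Φ L q ↔ ∀ β ∈ Φ, ∀ k : ℤ, ⟪β, (x : V)⟫ ≠ (q : ℝ) * k := by
  refine ⟨?_, fun hx => ⟨x, hx, rfl⟩⟩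
  rintro ⟨x', hx', hxx'⟩ β hβ k hk
  obtain ⟨z, hz⟩ := QuotientAddGroup.eq_iff_sub_mem.1 hxx'
  obtain ⟨n, hn⟩ := hL z.2 β hβ
  refine hx' β hβ (k + n) ?_
  rw [← sub_add_cancel x' x, ← hz]
  change ⟪β, q • (z : V) + x⟫ = _
  rw [inner_add_right, ← Nat.cast_smul_eq_nsmul ℝ, inner_smul_right, hn, hk]
  push_cast
  ring

lemma coweightLattice_le_dilate (d : ℕ) :
    coweightLattice Φ ≤ coweightLattice (dilate d Φ) := by
  rintro x hx _ ⟨β, hβ, rfl⟩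
  obtain ⟨n, hn⟩ := hx β hβ
  exact ⟨d * n, by rw [inner_smul_left, hn, RCLike.conj_to_real]; push_cast; rfl⟩

lemma dilate_one : dilate 1 Φ = Φ := by simp [dilate]

end Classes

/-! ### Orthogonal frames and their coweight lattices -/

section Frames

variable {V κ : Type*} [NormedAddCommGroup V]

/-- The members of a family of vectors and their negatives. -/
def signed (ε : κ → V) : Set V := {v | ∃ i, v = ε i ∨ v = -ε i}

/-- The vectors `± ε i ± ε j` (`i ≠ j`) and `± 2 ε i`: for an orthogonal basis `ε` of vectors of
the same length, the standard model of the root system of type `C`. -/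
def frameRoots (ε : κ → V) : Set V :=
  {v | v ≠ 0 ∧ ∃ a ∈ signed ε, ∃ b ∈ signed ε, v = a + b}

variable [InnerProductSpace ℝ V]

/-- The family `ε` is an orthogonal basis all of whose members have squared length `c`. -/
structure IsFrame (ε : κ → V) (c : ℝ) : Prop where
  pos : 0 < c
  inner_self : ∀ i, ⟪ε i, ε i⟫ = c
  orthogonal : ∀ {i j}, i ≠ j → ⟪ε i, ε j⟫ = 0
  span_eq_top : Submodule.span ℝ (Set.range ε) = ⊤

/-- The integers `y i` are the doubled inner products of `x` with the members of the family. The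
doubling makes the coordinates of all coweights integral. -/
def HasCoords (ε : κ → V) (x : V) (y : κ → ℤ) : Prop := ∀ i, 2 * ⟪ε i, x⟫ = y i

variable {ε : κ → V} {c : ℝ}

namespace IsFrame

lemma ext_inner (h : IsFrame ε c) {x y : V} (hxy : ∀ i, ⟪ε i, x⟫ = ⟪ε i, y⟫) : x = y := by
  have hext : innerₗ V x = innerₗ V y := LinearMap.ext_on_range h.span_eq_top fun i => by
    simpa only [innerₗ_apply_apply, real_inner_comm (ε i)] using hxy i
  exact ext_inner_right ℝ fun v => LinearMap.congr_fun hext v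

lemma exists_inner_eq [Finite κ] (h : IsFrame ε c) (z : κ → ℝ) : ∃ x : V, ∀ i, ⟪ε i, x⟫ = z i := by
  have := Fintype.ofFinite κ
  refine ⟨∑ j, (z j / c) • ε j, fun i => ?_⟩
  rw [inner_sum, Finset.sum_eq_single i]
  · rw [inner_smul_right, h.inner_self, div_mul_cancel₀ _ h.pos.ne']
  · intro j _ hj
    rw [inner_smul_right, h.orthogonal hj.symm, mul_zero]
  · simp

lemma forall_mem_frameRoots (h : IsFrame ε c) {p : V → Prop} (hneg : ∀ v, p v → p (-v)) :
    (∀ v ∈ frameRoots ε, p v) ↔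
      (∀ i, p ((2 : ℝ) • ε i)) ∧ ∀ i j, i ≠ j → p (ε i + ε j) ∧ p (ε i - ε j) := by
  have hne : ∀ (i) {v}, ⟪ε i, v⟫ ≠ 0 → v ≠ 0 := fun i v hv h0 => hv (by rw [h0, inner_zero_right])
  constructor
  · intro hp
    refine ⟨fun i => hp _ ⟨hne i ?_, ε i, ⟨i, .inl rfl⟩, ε i, ⟨i, .inl rfl⟩, two_smul ℝ _⟩,
      fun i j hij => ⟨hp _ ⟨hne i ?_, ε i, ⟨i, .inl rfl⟩, ε j, ⟨j, .inl rfl⟩, rfl⟩,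
        hp _ ⟨hne i ?_, ε i, ⟨i, .inl rfl⟩, -ε j, ⟨j, .inr rfl⟩, sub_eq_add_neg _ _⟩⟩⟩
    · rw [inner_smul_right, h.inner_self]
      exact mul_ne_zero two_ne_zero h.pos.ne'
    · rw [inner_add_right, h.inner_self, h.orthogonal hij, add_zero]
      exact h.pos.ne'
    · rw [inner_sub_right, h.inner_self, h.orthogonal hij, sub_zero]
      exact h.pos.ne'
  · rintro ⟨hlong, hshort⟩ v ⟨h0, _, ⟨i, rfl | rfl⟩, _, ⟨j, rfl | rfl⟩, rfl⟩ <;>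
      rcases eq_or_ne i j with rfl | hij
    · simpa only [two_smul] using hlong i
    · exact (hshort i j hij).1
    · exact absurd (add_neg_cancel _) h0
    · simpa only [sub_eq_add_neg] using (hshort i j hij).2
    · exact absurd (neg_add_cancel _) h0
    · have hp := hneg _ (hshort i j hij).2
      rwa [neg_sub, sub_eq_neg_add] at hp
    · simpa only [two_smul, neg_add] using hneg _ (hlong i)
    · simpa only [neg_add] using hneg _ (hshort i j hij).1

lemma mem_coweightLattice_iff (h : IsFrame ε c) {x : V} :
    x ∈ coweightLattice (frameRoots ε) ↔
      ∃ y : κ → ℤ, HasCoords ε x y ∧ ∀ i j, y i ≡ y j [ZMOD 2] := by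
  have hroots : x ∈ coweightLattice (frameRoots ε) ↔ _ :=
    h.forall_mem_frameRoots (p := fun v => ∃ n : ℤ, ⟪v, x⟫ = n) fun v ⟨n, hn⟩ =>
      ⟨-n, by rw [inner_neg_left, hn, Int.cast_neg]⟩
  simp only [inner_smul_left, inner_add_left, inner_sub_left, RCLike.conj_to_real] at hroots
  rw [hroots]
  constructor
  · rintro ⟨hlong, hshort⟩
    choose y hy using hlong
    refine ⟨y, hy, fun i j => ?_⟩
    rcases eq_or_ne i j with rfl | hij
    · rfl
    · obtain ⟨n, hn⟩ := (hshort j i hij.symm).2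
      refine Int.modEq_iff_dvd.2 ⟨n, ?_⟩
      rify
      rw [← hn, ← hy, ← hy, mul_sub]
  · rintro ⟨y, hy, hpar⟩
    refine ⟨fun i => ⟨y i, hy i⟩, fun i j _ => ?_⟩
    obtain ⟨n, hn⟩ := Int.modEq_iff_dvd.1 (hpar j i)
    rify at hn
    rw [← hy, ← hy] at hn
    exact ⟨⟨y j + n, by push_cast; linarith [hy j]⟩, ⟨n, by linarith⟩⟩

lemma exists_hasCoords [Finite κ] (h : IsFrame ε c) {y : κ → ℤ}
    (hy : ∀ i j, y i ≡ y j [ZMOD 2]) :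
    ∃ x : coweightLattice (frameRoots ε), HasCoords ε x y := by
  obtain ⟨x, hx⟩ := h.exists_inner_eq (fun i => (y i : ℝ) / 2)
  have hxy : HasCoords ε x y := fun i => by rw [hx, mul_div_cancel₀ _ two_ne_zero]
  exact ⟨⟨x, h.mem_coweightLattice_iff.2 ⟨y, hxy, hy⟩⟩, hxy⟩

end IsFrame

lemma HasCoords.sub {x x' : V} {y y' : κ → ℤ} (hx : HasCoords ε x y) (hx' : HasCoords ε x' y') :
    HasCoords ε (x - x') (y - y') := fun i => by
  rw [inner_sub_right, mul_sub, hx, hx', Pi.sub_apply, Int.cast_sub]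

lemma HasCoords.nsmul {x : V} {y : κ → ℤ} (hx : HasCoords ε x y) (n : ℕ) :
    HasCoords ε (n • x) (n • y) := fun i => by
  rw [← Nat.cast_smul_eq_nsmul ℝ, inner_smul_right, mul_left_comm, hx]
  simp

lemma HasCoords.unique {x : V} {y y' : κ → ℤ} (hy : HasCoords ε x y) (hy' : HasCoords ε x y') :
    y = y' := funext fun i => by exact_mod_cast (hy i).symm.trans (hy' i)

lemma IsFrame.eq_of_hasCoords (h : IsFrame ε c) {x x' : V} {y : κ → ℤ} (hx : HasCoords ε x y)
    (hx' : HasCoords ε x' y) : x = x' :=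
  h.ext_inner fun i => mul_left_cancel₀ two_ne_zero ((hx i).trans (hx' i).symm)

variable {q d : ℕ}

lemma HasCoords.parity_eq (h : IsFrame ε c) {x : coweightLattice (frameRoots ε)} {y : κ → ℤ}
    (hx : HasCoords ε x y) (i j : κ) :
    parity q (y i : ZMod (2 * q)) = parity q (y j : ZMod (2 * q)) := by
  obtain ⟨y', hy', hpar⟩ := h.mem_coweightLattice_iff.1 x.2
  obtain rfl := hx.unique hy'
  rw [map_intCast, map_intCast]
  exact (ZMod.intCast_eq_intCast_iff _ _ 2).2 (hpar i j)

lemma intCast_eq_zero_iff_exists_even {a : ℤ} :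
    (a : ZMod (2 * q)) = 0 ↔ ∃ t, Even t ∧ a = q * t := by
  rw [ZMod.intCast_zmod_eq_zero_iff_dvd]
  constructor
  · rintro ⟨k, rfl⟩
    exact ⟨2 * k, even_two_mul k, by push_cast; ring⟩
  · rintro ⟨_, ⟨k, rfl⟩, rfl⟩
    exact ⟨k, by push_cast; ring⟩

lemma intCast_eq_natCast_iff_exists_odd {a : ℤ} :
    (a : ZMod (2 * q)) = q ↔ ∃ t, Odd t ∧ a = q * t := by
  rw [← sub_eq_zero, ← Int.cast_natCast q, ← Int.cast_sub, intCast_eq_zero_iff_exists_even]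
  constructor
  · rintro ⟨t, ht, hat⟩
    exact ⟨t + 1, ht.add_one, by linear_combination hat⟩
  · rintro ⟨t, ht, rfl⟩
    exact ⟨t - 1, ht.sub_odd odd_one, by ring⟩

lemma IsFrame.mem_multiples_iff [Finite κ] (h : IsFrame ε c)
    {x : coweightLattice (frameRoots ε)} {y : κ → ℤ} (hx : HasCoords ε x y) :
    x ∈ multiples (coweightLattice (frameRoots ε)) q ↔
      (∀ i, (y i : ZMod (2 * q)) = 0) ∨ ∀ i, (y i : ZMod (2 * q)) = q := by
  simp only [intCast_eq_zero_iff_exists_even, intCast_eq_natCast_iff_exists_odd]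
  constructor
  · rintro ⟨z, rfl⟩
    obtain ⟨t, hz, ht⟩ := h.mem_coweightLattice_iff.1 z.2
    obtain rfl : y = q • t := hx.unique (hz.nsmul q)
    by_cases heven : ∀ i, Even (t i)
    · exact .inl fun i => ⟨t i, heven i, by simp⟩
    · obtain ⟨j, hj⟩ := not_forall.1 heven
      refine .inr fun i => ⟨t i, ?_, by simp⟩
      rw [Int.odd_iff, ht i j, ← Int.odd_iff]
      exact Int.not_even_iff_odd.1 hj
  · intro hy
    obtain ⟨t, ht, rfl⟩ : ∃ t : κ → ℤ, (∀ i j, t i ≡ t j [ZMOD 2]) ∧ y = q • t := by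
      rcases hy with hy | hy <;> choose t ht hyt using hy
      · exact ⟨t, fun i j => (Int.even_iff.1 (ht i)).trans (Int.even_iff.1 (ht j)).symm,
          funext fun i => by simp [hyt]⟩
      · exact ⟨t, fun i j => (Int.odd_iff.1 (ht i)).trans (Int.odd_iff.1 (ht j)).symm,
          funext fun i => by simp [hyt]⟩
    obtain ⟨z, hz⟩ := h.exists_hasCoords ht
    exact ⟨z, Subtype.ext (h.eq_of_hasCoords (hz.nsmul q) hx)⟩

lemma IsFrame.mk_eq_mk_iff [Finite κ] (h : IsFrame ε c)
    {x x' : coweightLattice (frameRoots ε)} {y y' : κ → ℤ} (hx : HasCoords ε x y)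
    (hx' : HasCoords ε x' y') :
    (QuotientAddGroup.mk x : ModQ (coweightLattice (frameRoots ε)) q) = QuotientAddGroup.mk x' ↔
      (∀ i, (y i : ZMod (2 * q)) = y' i) ∨ ∀ i, (y i : ZMod (2 * q)) = y' i + q := by
  rw [QuotientAddGroup.eq_iff_sub_mem, h.mem_multiples_iff (hx.sub hx')]
  simp only [Pi.sub_apply, Int.cast_sub, sub_eq_iff_eq_add', add_zero]

lemma HasCoords.avoidsRoots_iff (h : IsFrame ε c) {x : V} {y : κ → ℤ} (hx : HasCoords ε x y) :
    AvoidsRoots q d (fun i => (y i : ZMod (2 * q))) ↔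
      ∀ β ∈ dilate d (frameRoots ε), ∀ k : ℤ, ⟪β, x⟫ ≠ (q : ℝ) * k := by
  have hresidue : ∀ {v : V} {a : ℤ}, 2 * ⟪v, x⟫ = a →
      ((∀ k : ℤ, ⟪(d : ℝ) • v, x⟫ ≠ (q : ℝ) * k) ↔
        (d : ZMod (2 * q)) * (a : ZMod (2 * q)) ≠ 0) := by
    intro v a ha
    rw [Ne, ← Int.cast_natCast (R := ZMod (2 * q)) d, ← Int.cast_mul,
      ZMod.intCast_zmod_eq_zero_iff_dvd, dvd_def, not_exists]
    refine forall_congr' fun k => not_congr ?_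
    rify
    rw [← ha, inner_smul_left, RCLike.conj_to_real, mul_left_comm, mul_assoc,
      mul_right_inj' two_ne_zero]
  rw [dilate, Set.forall_mem_image, h.forall_mem_frameRoots fun v hv k hk => hv (-k) (by
    rw [← neg_neg v, smul_neg, inner_neg_left, hk, Int.cast_neg, mul_neg])]
  refine and_congr (forall_congr' fun i => ?_) (forall₃_congr fun i j _ => and_congr ?_ ?_)
  · rw [hresidue (a := 2 * y i) (by rw [inner_smul_left, RCLike.conj_to_real, hx]; simp)]
    push_cast
    rfl
  · rw [hresidue (a := y i + y j) (by rw [inner_add_left, mul_add, hx, hx, Int.cast_add])]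
    push_cast
    rfl
  · rw [hresidue (a := y i - y j) (by rw [inner_sub_left, mul_sub, hx, hx, Int.cast_sub])]
    push_cast
    rfl

lemma IsFrame.exists_coweight [Finite κ] [NeZero q] (h : IsFrame ε c) {f : κ → ZMod (2 * q)}
    (hf : ∀ i j, parity q (f i) = parity q (f j)) :
    ∃ (x : coweightLattice (frameRoots ε)) (y : κ → ℤ),
      HasCoords ε x y ∧ (fun i => (y i : ZMod (2 * q))) = f := by
  have hval : ∀ i, (((f i).val : ℤ) : ZMod (2 * q)) = f i := fun i => by simp
  obtain ⟨x, hx⟩ := h.exists_hasCoords (y := fun i => (f i).val) fun i j => by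
    have hpar := hf i j
    rw [← hval i, ← hval j, map_intCast, map_intCast] at hpar
    exact (ZMod.intCast_eq_intCast_iff _ _ 2).1 hpar
  exact ⟨x, _, hx, funext hval⟩

lemma natCast_self_ne_zero [NeZero q] : (q : ZMod (2 * q)) ≠ 0 := fun hq0 => by
  rw [ZMod.natCast_eq_zero_iff] at hq0
  exact absurd (Nat.le_of_dvd (NeZero.pos q) hq0) (by have := NeZero.pos q; lia)

lemma natCast_self_add_self : (q : ZMod (2 * q)) + q = 0 := by
  simpa [two_mul] using ZMod.natCast_self (2 * q)

/-- Modulo `q L`, the coordinates of a coweight are determined modulo `2 q` up to adding `q` to all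
of them at once, so the coordinate tuples count every class twice. -/
lemma IsFrame.two_mul_natCard_classes [Finite κ] [Nonempty κ] [NeZero q] (h : IsFrame ε c)
    {S : Set (ModQ (coweightLattice (frameRoots ε)) q)} {Y : Set (κ → ZMod (2 * q))}
    (hparity : ∀ f ∈ Y, ∀ i j, parity q (f i) = parity q (f j))
    (hS : ∀ (x : coweightLattice (frameRoots ε)) (y : κ → ℤ), HasCoords ε x y →
      (QuotientAddGroup.mk x ∈ S ↔ (fun i => (y i : ZMod (2 * q))) ∈ Y)) :
    2 * Nat.card S = Nat.card Y := by
  choose x y hxy hyf using fun f : Y => h.exists_coweight (hparity f f.2)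
  let classOf : Y → S := fun f =>
    ⟨QuotientAddGroup.mk (x f), (hS _ _ (hxy f)).2 ((hyf f).symm ▸ f.2)⟩
  have hfiber : ∀ t : S, Nat.card {f : Y // classOf f = t} = 2 := by
    rintro ⟨t, ht⟩
    induction t using QuotientAddGroup.induction_on with | H x' => ?_
    obtain ⟨y', hy', hpar⟩ := h.mem_coweightLattice_iff.1 x'.2
    let f₀ : κ → ZMod (2 * q) := fun i => y' i
    have hclass : ∀ f : Y, classOf f = ⟨QuotientAddGroup.mk x', ht⟩ ↔
        (f : κ → ZMod (2 * q)) ∈ ({f₀, f₀ + fun _ => (q : ZMod (2 * q))} : Set _) := fun f => by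
      rw [Subtype.mk.injEq, h.mk_eq_mk_iff (hxy f) hy', Set.mem_insert_iff,
        Set.mem_singleton_iff, funext_iff, funext_iff, ← hyf f]
      rfl
    have hsub : ({f₀, f₀ + fun _ => (q : ZMod (2 * q))} : Set _) ⊆ Y := by
      have hf₀ : f₀ ∈ Y := (hS _ _ hy').1 ht
      obtain ⟨x'', hx''⟩ := h.exists_hasCoords (y := y' + fun _ => (q : ℤ)) fun i j =>
        (hpar i j).add_right _
      have hmk : (QuotientAddGroup.mk x'' : ModQ _ q) = QuotientAddGroup.mk x' :=
        (h.mk_eq_mk_iff hx'' hy').2 (.inr fun i => by simp)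
      have hf₀q := (hS _ _ hx'').1 (hmk ▸ ht)
      simp only [Pi.add_apply, Int.cast_add, Int.cast_natCast] at hf₀q
      exact Set.insert_subset hf₀ (Set.singleton_subset_iff.2 hf₀q)
    have hne : f₀ ≠ f₀ + fun _ => (q : ZMod (2 * q)) := fun h0 =>
      natCast_self_ne_zero (congrFun (left_eq_add.1 h0) (Classical.arbitrary κ))
    exact (Nat.card_congr ((Equiv.subtypeEquivRight hclass).trans
      (Equiv.subtypeSubtypeEquivSubtype fun hf => hsub hf))).trans (Set.ncard_pair hne)
  have hsurj : Function.Surjective classOf := fun t =>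
    have := Nat.card_ne_zero.1 ((hfiber t).trans_ne two_ne_zero)
    let ⟨f⟩ := this.1
    ⟨f, f.2⟩
  exact (natCard_eq_mul_natCard_of_surjective hsurj hfiber).symm

lemma HasCoords.mk_mem_modComplement_iff (h : IsFrame ε c) {x : coweightLattice (frameRoots ε)}
    {y : κ → ℤ} (hx : HasCoords ε x y) :
    QuotientAddGroup.mk x ∈
        modComplement (dilate d (frameRoots ε)) (coweightLattice (frameRoots ε)) q ↔
      (fun i => (y i : ZMod (2 * q))) ∈ avoidingTuples q d κ := by
  rw [avoidingTuples, Set.mem_ofPred_eq, hx.avoidsRoots_iff h, and_iff_right (hx.parity_eq h)]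
  exact EquivQuasi.mk_mem_modComplement_iff (coweightLattice_le_dilate d)

lemma IsFrame.two_mul_charQuasi [Finite κ] [Nonempty κ] [NeZero q] (h : IsFrame ε c) (d : ℕ) :
    2 * charQuasi (dilate d (frameRoots ε)) (coweightLattice (frameRoots ε)) q =
      Nat.card (avoidingTuples q d κ) :=
  h.two_mul_natCard_classes (fun _ hf => hf.1) fun _ _ hx => hx.mk_mem_modComplement_iff h

variable {s : ℕ}

lemma IsFrame.charQuasi_of_odd [Finite κ] [Nonempty κ] (h : IsFrame ε c) (hq : q = d * s)
    (hd : 0 < d) (hs : Odd s) :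
    (charQuasi (dilate d (frameRoots ε)) (coweightLattice (frameRoots ε)) q : ℤ) =
      ∏ k ∈ Finset.Icc 1 (Nat.card κ), ((q : ℤ) - d * (2 * k - 1)) := by
  have : NeZero q := ⟨hq ▸ (Nat.mul_pos hd hs.pos).ne'⟩
  refine mul_left_cancel₀ two_ne_zero ?_
  rw [← natCard_avoidingTuples_of_odd hq hd hs, ← h.two_mul_charQuasi]
  push_cast
  rfl

lemma IsFrame.charQuasi_of_even [Finite κ] [Nonempty κ] (h : IsFrame ε c) (hq : q = d * s)
    (hq0 : 0 < q) (hs : Even s) :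
    (charQuasi (dilate d (frameRoots ε)) (coweightLattice (frameRoots ε)) q : ℤ) =
      (∏ k ∈ Finset.Icc 1 (Nat.card κ - 1), ((q : ℤ) - 2 * d * k)) * (q - d * Nat.card κ) := by
  have : NeZero q := ⟨hq0.ne'⟩
  refine mul_left_cancel₀ two_ne_zero ?_
  rw [← natCard_avoidingTuples_of_even hq hq0 hs, ← h.two_mul_charQuasi]
  push_cast
  rfl

end Frames

/-! ### The root system of a frame -/

section SignedVectors

variable {V κ : Type*} [NormedAddCommGroup V] {ε : κ → V} {c : ℝ}

lemma neg_mem_signed {a : V} (ha : a ∈ signed ε) : -a ∈ signed ε := by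
  obtain ⟨i, rfl | rfl⟩ := ha
  exacts [⟨i, .inr rfl⟩, ⟨i, .inl (neg_neg _)⟩]

lemma neg_mem_frameRoots {v : V} (hv : v ∈ frameRoots ε) : -v ∈ frameRoots ε := by
  obtain ⟨h0, a, ha, b, hb, rfl⟩ := hv
  exact ⟨neg_ne_zero.2 h0, _, neg_mem_signed ha, _, neg_mem_signed hb, neg_add a b⟩

lemma finite_signed [Finite κ] : (signed ε).Finite := by
  refine ((Set.finite_range ε).union (Set.finite_range fun i => -ε i)).subset ?_
  rintro _ ⟨i, rfl | rfl⟩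
  exacts [.inl ⟨i, rfl⟩, .inr ⟨i, rfl⟩]

lemma finite_frameRoots [Finite κ] : (frameRoots ε).Finite := by
  refine (Set.Finite.image2 (· + ·) (finite_signed (ε := ε)) (finite_signed (ε := ε))).subset ?_
  rintro _ ⟨-, a, ha, b, hb, rfl⟩
  exact ⟨a, ha, b, hb, rfl⟩

variable [InnerProductSpace ℝ V]

namespace IsFrame

lemma inner_self_of_mem_signed (h : IsFrame ε c) {a : V} (ha : a ∈ signed ε) : ⟪a, a⟫ = c := by
  obtain ⟨i, rfl | rfl⟩ := ha
  · exact h.inner_self i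
  · rw [inner_neg_neg, h.inner_self i]

lemma eq_or_eq_neg_or_inner_eq_zero (h : IsFrame ε c) {a b : V} (ha : a ∈ signed ε)
    (hb : b ∈ signed ε) : a = b ∨ a = -b ∨ ⟪a, b⟫ = 0 := by
  obtain ⟨i, hi⟩ := ha
  obtain ⟨j, hj⟩ := hb
  rcases eq_or_ne i j with rfl | hij
  · rcases hi with rfl | rfl <;> rcases hj with rfl | rfl <;> simp
  · rcases hi with rfl | rfl <;> rcases hj with rfl | rfl <;>
    simp [inner_neg_left, inner_neg_right, h.orthogonal hij]

lemma two_smul_mem_frameRoots (h : IsFrame ε c) (i : κ) : (2 : ℝ) • ε i ∈ frameRoots ε :=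
  ((h.forall_mem_frameRoots (p := (· ∈ frameRoots ε)) fun _ => neg_mem_frameRoots).1
    fun _ => id).1 i

lemma sub_mem_frameRoots (h : IsFrame ε c) {i j : κ} (hij : i ≠ j) : ε i - ε j ∈ frameRoots ε :=
  (((h.forall_mem_frameRoots (p := (· ∈ frameRoots ε)) fun _ => neg_mem_frameRoots).1
    fun _ => id).2 i j hij).2

lemma span_frameRoots (h : IsFrame ε c) : Submodule.span ℝ (frameRoots ε) = ⊤ := by
  rw [eq_top_iff, ← h.span_eq_top, Submodule.span_le]
  rintro _ ⟨i, rfl⟩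
  exact (Submodule.smul_mem_iff _ two_ne_zero).1
    (Submodule.subset_span (h.two_smul_mem_frameRoots i))

lemma inner_add_self (h : IsFrame ε c) {a b : V} (ha : a ∈ signed ε) (hb : b ∈ signed ε) :
    ⟪a + b, a + b⟫ = 2 * ⟪a + b, a⟫ := by
  rw [inner_add_right, inner_add_left, inner_add_left, h.inner_self_of_mem_signed ha,
    h.inner_self_of_mem_signed hb, real_inner_comm b a]
  ring

lemma inner_self_of_mem_frameRoots (h : IsFrame ε c) {v : V} (hv : v ∈ frameRoots ε) :
    ⟪v, v⟫ = 4 * c ∨ ⟪v, v⟫ = 2 * c := by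
  obtain ⟨h0, a, ha, b, hb, rfl⟩ := hv
  rw [h.inner_add_self ha hb, inner_add_left, h.inner_self_of_mem_signed ha]
  rcases h.eq_or_eq_neg_or_inner_eq_zero hb ha with rfl | rfl | hba
  · exact .inl (by rw [h.inner_self_of_mem_signed ha]; ring)
  · exact absurd (add_neg_cancel _) h0
  · exact .inr (by rw [hba, add_zero])

lemma exists_reflection_mem_signed (h : IsFrame ε c) {u v : V} (hv : v ∈ frameRoots ε)
    (hu : u ∈ signed ε) :
    ∃ z : ℤ, 2 * ⟪v, u⟫ / ⟪v, v⟫ = z ∧ u - (z : ℝ) • v ∈ signed ε := by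
  obtain ⟨h0, a, ha, b, hb, rfl⟩ := hv
  have hne : ⟪a + b, a + b⟫ ≠ 0 := inner_self_ne_zero.2 h0
  have hone : ∀ {a b : V}, a ∈ signed ε → b ∈ signed ε → ⟪a + b, a + b⟫ ≠ 0 →
      2 * ⟪a + b, a⟫ / ⟪a + b, a + b⟫ = 1 := fun ha hb hne => by
    rw [← h.inner_add_self ha hb, div_self hne]
  have ha1 := hone ha hb hne
  have hb1 : 2 * ⟪a + b, b⟫ / ⟪a + b, a + b⟫ = 1 := by
    rw [add_comm a b] at hne ⊢
    exact hone hb ha hne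
  rcases h.eq_or_eq_neg_or_inner_eq_zero hu ha with rfl | rfl | hua
  · exact ⟨1, by rw [ha1, Int.cast_one], by simpa using neg_mem_signed hb⟩
  · exact ⟨-1, by rw [inner_neg_right, mul_neg, neg_div, ha1, Int.cast_neg, Int.cast_one],
      by simpa using hb⟩
  rcases h.eq_or_eq_neg_or_inner_eq_zero hu hb with rfl | rfl | hub
  · exact ⟨1, by rw [hb1, Int.cast_one], by simpa using neg_mem_signed ha⟩
  · exact ⟨-1, by rw [inner_neg_right, mul_neg, neg_div, hb1, Int.cast_neg, Int.cast_one],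
      by simpa using ha⟩
  · rw [real_inner_comm, inner_add_right, hua, hub]
    exact ⟨0, by simp, by simpa using hu⟩

lemma exists_intCast_eq (h : IsFrame ε c) {v w : V} (hv : v ∈ frameRoots ε)
    (hw : w ∈ frameRoots ε) : ∃ z : ℤ, 2 * ⟪v, w⟫ / ⟪v, v⟫ = z := by
  obtain ⟨-, a, ha, b, hb, rfl⟩ := hw
  obtain ⟨z, hz, -⟩ := h.exists_reflection_mem_signed hv ha
  obtain ⟨z', hz', -⟩ := h.exists_reflection_mem_signed hv hb
  exact ⟨z + z', by rw [inner_add_right, mul_add, add_div, hz, hz', Int.cast_add]⟩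

lemma reflection_mem_frameRoots (h : IsFrame ε c) {v w : V} (hv : v ∈ frameRoots ε)
    (hw : w ∈ frameRoots ε) : w - (2 * ⟪v, w⟫ / ⟪v, v⟫) • v ∈ frameRoots ε := by
  have hvv : ⟪v, v⟫ ≠ 0 := inner_self_ne_zero.2 hv.1
  have hinner : ⟪v, w - (2 * ⟪v, w⟫ / ⟪v, v⟫) • v⟫ = -⟪v, w⟫ := by
    rw [inner_sub_right, inner_smul_right, div_mul_cancel₀ _ hvv]
    ring
  refine ⟨fun h0 => hw.1 ?_, ?_⟩
  · rw [h0, inner_zero_right, zero_eq_neg] at hinner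
    simpa [hinner] using h0
  · obtain ⟨-, a, ha, b, hb, rfl⟩ := hw
    obtain ⟨z, hz, hza⟩ := h.exists_reflection_mem_signed hv ha
    obtain ⟨z', hz', hzb⟩ := h.exists_reflection_mem_signed hv hb
    refine ⟨_, hza, _, hzb, ?_⟩
    rw [inner_add_right, mul_add, add_div, hz, hz']
    module

/-- Proportional roots have a ratio `t` with `2 t` an integer; as `t ^ 2` is a ratio of two of the
squared lengths `2 c` and `4 c`, it must be `1`. -/
lemma eq_or_eq_neg_of_eq_smul (h : IsFrame ε c) {v w : V} (hv : v ∈ frameRoots ε)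
    (hw : w ∈ frameRoots ε) {t : ℝ} (hvw : v = t • w) : v = w ∨ v = -w := by
  have hww : ⟪w, w⟫ ≠ 0 := inner_self_ne_zero.2 hw.1
  obtain ⟨z, hz⟩ := h.exists_intCast_eq hw hv
  have hzt : (z : ℝ) = 2 * t := by
    rw [← hz, hvw, inner_smul_right, ← mul_assoc, mul_div_cancel_right₀ _ hww]
  have hlength : (z : ℝ) ^ 2 * ⟪w, w⟫ = 4 * ⟪v, v⟫ := by
    rw [hvw, inner_smul_right, inner_smul_left, RCLike.conj_to_real, hzt]
    ring
  have hsq : ∀ {m : ℤ}, (z : ℝ) ^ 2 * c = m * c → z ^ 2 = m := fun hm => by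
    exact_mod_cast mul_right_cancel₀ h.pos.ne' hm
  have hz2 : z ^ 2 = 2 ∨ z ^ 2 = 4 ∨ z ^ 2 = 8 := by
    rcases h.inner_self_of_mem_frameRoots hv with hv2 | hv2 <;>
    rcases h.inner_self_of_mem_frameRoots hw with hw2 | hw2 <;>
    rw [hv2, hw2] at hlength
    · exact .inr (.inl (hsq (by push_cast; linarith)))
    · exact .inr (.inr (hsq (by push_cast; linarith)))
    · exact .inl (hsq (by push_cast; linarith))
    · exact .inr (.inl (hsq (by push_cast; linarith)))
  have hz_eq : z = 2 ∨ z = -2 := by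
    have hsq_lt : z ^ 2 < 3 ^ 2 := by lia
    obtain ⟨hgt, hlt⟩ := abs_lt.1 (abs_lt_of_sq_lt_sq hsq_lt (by norm_num))
    interval_cases z <;> lia
  rcases hz_eq with rfl | rfl
  · exact .inl (by rw [hvw, show t = 1 by norm_num at hzt; linarith, one_smul])
  · exact .inr (by rw [hvw, show t = -1 by norm_num at hzt; linarith, neg_one_smul])

lemma linearIndependent (h : IsFrame ε c) : LinearIndependent ℝ ε :=
  linearIndependent_of_ne_zero_of_inner_eq_zero
    (fun i => inner_self_ne_zero.1 ((h.inner_self i).trans_ne h.pos.ne')) fun _ _ => h.orthogonal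

/-- A frame, as a basis. -/
def basis (h : IsFrame ε c) : Module.Basis κ ℝ V := .mk h.linearIndependent h.span_eq_top.ge

end IsFrame

end SignedVectors

section SimpleRoots

variable {V : Type*} [NormedAddCommGroup V] [InnerProductSpace ℝ V] {n : ℕ} {ε : Fin n → V} {c : ℝ}

/-- The simple roots `ε i - ε (i + 1)` and `2 ε (n - 1)` of the root system of a frame. -/
def frameSimple (ε : Fin n → V) (i : Fin n) : V :=
  if h : i.1 + 1 < n then ε i - ε ⟨i.1 + 1, h⟩ else (2 : ℝ) • ε i

lemma frameSimple_of_lt {i : Fin n} (hi : i.1 + 1 < n) :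
    frameSimple ε i = ε i - ε ⟨i.1 + 1, hi⟩ := dif_pos hi

lemma frameSimple_of_not_lt {i : Fin n} (hi : ¬ i.1 + 1 < n) :
    frameSimple ε i = (2 : ℝ) • ε i := dif_neg hi

lemma sub_mem_closure_frameSimple {i j : Fin n} (hij : i ≤ j) :
    ε i - ε j ∈ AddSubmonoid.closure (Set.range (frameSimple ε)) := by
  suffices ∀ k (hk : k < n), i.1 ≤ k →
      ε i - ε ⟨k, hk⟩ ∈ AddSubmonoid.closure (Set.range (frameSimple ε)) from this j j.2 hij
  intro k hk hik
  induction k, hik using Nat.le_induction with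
  | base => simp
  | succ k _ ih =>
    have hsimple := AddSubmonoid.subset_closure
      (Set.mem_range_self (f := frameSimple ε) ⟨k, by lia⟩)
    rw [frameSimple_of_lt hk] at hsimple
    simpa only [sub_add_sub_cancel] using add_mem (ih (by lia)) hsimple

lemma add_mem_closure_frameSimple (i j : Fin n) :
    ε i + ε j ∈ AddSubmonoid.closure (Set.range (frameSimple ε)) := by
  let last : Fin n := ⟨n - 1, Nat.sub_one_lt i.pos.ne'⟩
  have hlast : ∀ i : Fin n, i ≤ last := fun i => Fin.le_def.2 (Nat.le_sub_one_of_lt i.2)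
  have hsimple := AddSubmonoid.subset_closure (Set.mem_range_self (f := frameSimple ε) last)
  rw [frameSimple_of_not_lt (by simp only [last]; lia)] at hsimple
  convert add_mem (add_mem (sub_mem_closure_frameSimple (hlast i))
    (sub_mem_closure_frameSimple (hlast j))) hsimple using 1
  module

lemma mem_or_neg_mem_closure_frameSimple {v : V} (hv : v ∈ frameRoots ε) :
    v ∈ AddSubmonoid.closure (Set.range (frameSimple ε)) ∨
      -v ∈ AddSubmonoid.closure (Set.range (frameSimple ε)) := by
  have hsub : ∀ i j, ε i - ε j ∈ AddSubmonoid.closure (Set.range (frameSimple ε)) ∨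
      -(ε i - ε j) ∈ AddSubmonoid.closure (Set.range (frameSimple ε)) := fun i j => by
    rw [neg_sub]
    exact (le_total i j).imp sub_mem_closure_frameSimple sub_mem_closure_frameSimple
  obtain ⟨-, _, ⟨i, rfl | rfl⟩, _, ⟨j, rfl | rfl⟩, rfl⟩ := hv
  · exact .inl (add_mem_closure_frameSimple i j)
  · rw [← sub_eq_add_neg]
    exact hsub i j
  · rw [neg_add_eq_sub]
    exact hsub j i
  · rw [← neg_add, neg_neg]
    exact .inr (add_mem_closure_frameSimple i j)

namespace IsFrame

lemma frameSimple_mem (h : IsFrame ε c) (i : Fin n) : frameSimple ε i ∈ frameRoots ε := by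
  by_cases hi : i.1 + 1 < n
  · rw [frameSimple_of_lt hi]
    exact h.sub_mem_frameRoots (by simp [Fin.ext_iff])
  · rw [frameSimple_of_not_lt hi]
    exact h.two_smul_mem_frameRoots i

lemma span_frameSimple (h : IsFrame ε c) :
    Submodule.span ℝ (Set.range (frameSimple ε)) = ⊤ := by
  rw [eq_top_iff, ← h.span_frameRoots, Submodule.span_le]
  intro v hv
  rcases mem_or_neg_mem_closure_frameSimple hv with hv | hv
  · exact Submodule.closure_subset_span hv
  · exact neg_mem_iff.1 (Submodule.closure_subset_span (R := ℝ) hv)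

lemma linearIndependent_frameSimple (h : IsFrame ε c) : LinearIndependent ℝ (frameSimple ε) :=
  have := Module.Basis.finiteDimensional_of_finite h.basis
  linearIndependent_of_top_le_span_of_card_eq_finrank h.span_frameSimple.ge
    (Module.finrank_eq_card_basis h.basis).symm

lemma inner_eq_ite (h : IsFrame ε c) (i j : Fin n) : ⟪ε i, ε j⟫ = if i = j then c else 0 := by
  split_ifs with hij
  · rw [hij, h.inner_self]
  · exact h.orthogonal hij

lemma frameSimple_pairing (h : IsFrame ε c) (i j : Fin n) :
    2 * ⟪frameSimple ε i, frameSimple ε j⟫ / ⟪frameSimple ε j, frameSimple ε j⟫ =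
      CartanMatrix.C n i j := by
  have hc := h.pos.ne'
  unfold frameSimple CartanMatrix.C
  simp only [Matrix.of_apply]
  by_cases hi : i.1 + 1 < n <;> by_cases hj : j.1 + 1 < n <;>
  simp only [hi, hj, dif_pos, dif_neg, not_false_eq_true, inner_smul_left, inner_smul_right,
    RCLike.conj_to_real,
    inner_sub_left, inner_sub_right, h.inner_eq_ite, Fin.ext_iff, if_true] <;>
  obtain hij | hij | hij | hij | hij : i.1 + 1 < j.1 ∨ i.1 + 1 = j.1 ∨ i.1 = j.1 ∨
    j.1 + 1 = i.1 ∨ j.1 + 1 < i.1 := by lia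
  all_goals first
    | (exfalso; lia)
    | skip
  all_goals
    simp (disch := lia) only [if_pos, if_neg]
    push_cast
    try field_simp
    try ring_nf
    try rw [mul_inv_cancel₀ hc]

end IsFrame

end SimpleRoots

section RootPairing

variable {V κ : Type*} [NormedAddCommGroup V] [InnerProductSpace ℝ V]

lemma isPerfPair_innerₗ [FiniteDimensional ℝ V] : (innerₗ V).IsPerfPair :=
  .of_injective (fun _ _ hxy => ext_inner_right ℝ fun v => DFunLike.congr_fun hxy v)
    fun _ _ hxy => ext_inner_left ℝ fun v => DFunLike.congr_fun hxy v

/-- The coroot `2 v / (v, v)` of a root `v` of a frame. -/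
def frameCoroot (ε : κ → V) : frameRoots ε ↪ V where
  toFun v := (2 / ⟪(v : V), (v : V)⟫) • (v : V)
  inj' := by
    intro v w hvw
    have hv : ⟪(v : V), (v : V)⟫ ≠ 0 := inner_self_ne_zero.2 v.2.1
    have hw : ⟪(w : V), (w : V)⟫ ≠ 0 := inner_self_ne_zero.2 w.2.1
    have hlength : ⟪(v : V), (v : V)⟫ = ⟪(w : V), (w : V)⟫ := by
      have hself := congrArg (fun x => ⟪x, x⟫) hvw
      simp only [inner_smul_left, inner_smul_right, RCLike.conj_to_real] at hself
      field_simp at hself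
      exact hself.symm
    simp only [hlength] at hvw
    exact Subtype.ext (smul_right_injective V (div_ne_zero two_ne_zero hw) hvw)

namespace IsFrame

/-- The root system of a frame, as a root pairing of the Euclidean space with itself. -/
def rootPairing [FiniteDimensional ℝ V] [Finite κ] {ε : κ → V} {c : ℝ} (h : IsFrame ε c) :
    RootPairing (frameRoots ε) ℝ V V :=
  have := isPerfPair_innerₗ (V := V)
  have := finite_frameRoots (ε := ε).to_subtype
  .mk'' (innerₗ V) (Function.Embedding.subtype _) (frameCoroot ε)
    (fun v => by
      change ⟪(v : V), (2 / ⟪(v : V), (v : V)⟫) • (v : V)⟫ = 2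
      rw [inner_smul_right, div_mul_cancel₀ _ (inner_self_ne_zero.2 v.2.1)])
    (by
      rintro v _ ⟨w, rfl⟩
      refine ⟨⟨_, h.reflection_mem_frameRoots v.2 w.2⟩, ?_⟩
      change (w : V) - _ = (w : V) - ⟪(w : V), (2 / ⟪(v : V), (v : V)⟫) • (v : V)⟫ • (v : V)
      rw [inner_smul_right, real_inner_comm (w : V), mul_div_right_comm])
    (by simpa using h.span_frameRoots)

section Properties

variable [FiniteDimensional ℝ V] [Finite κ] {ε : κ → V} {c : ℝ} (h : IsFrame ε c)

lemma rootPairing_root (v : frameRoots ε) : h.rootPairing.root v = v := rfl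

lemma rootPairing_pairing (v w : frameRoots ε) :
    h.rootPairing.pairing v w = 2 * ⟪(v : V), (w : V)⟫ / ⟪(w : V), (w : V)⟫ := by
  change ⟪(v : V), (2 / ⟪(w : V), (w : V)⟫) • (w : V)⟫ = _
  rw [inner_smul_right, mul_div_right_comm]

lemma exists_intCast_eq_pairing (v w : frameRoots ε) :
    ∃ z : ℤ, (z : ℝ) = h.rootPairing.pairing v w := by
  obtain ⟨z, hz⟩ := h.exists_intCast_eq w.2 v.2
  exact ⟨z, by rw [h.rootPairing_pairing, real_inner_comm, hz]⟩

lemma isEuclidean : IsEuclidean h.rootPairing where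
  pairing_eq _ _ := rfl
  coroot_eq _ := rfl

lemma isCrystallographic : h.rootPairing.IsCrystallographic where
  exists_value := h.exists_intCast_eq_pairing

lemma isRootSystem : h.rootPairing.IsRootSystem :=
  have := isPerfPair_innerₗ (V := V)
  have := finite_frameRoots (ε := ε).to_subtype
  RootPairing.isRootSystem_mk'' (hsp := by simpa using h.span_frameRoots)
    h.exists_intCast_eq_pairing

lemma isReduced : h.rootPairing.IsReduced where
  eq_or_eq_neg v w hvw := by
    rw [LinearIndependent.pair_symm_iff, linearIndependent_fin2] at hvw
    simp only [Matrix.cons_val_one, Matrix.cons_val_zero, not_and, not_forall, not_not] at hvw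
    obtain ⟨t, ht⟩ := hvw v.2.1
    refine (h.eq_or_eq_neg_of_eq_smul w.2 v.2 ht.symm).imp Eq.symm fun hwv => ?_
    rw [h.rootPairing_root, h.rootPairing_root, hwv, neg_neg]

end Properties

section Base

variable {n : ℕ} {ε : Fin n → V} {c : ℝ} (h : IsFrame ε c)

/-- The simple roots of a frame, as elements of the index set of its root system. -/
def simple (i : Fin n) : frameRoots ε := ⟨_, h.frameSimple_mem i⟩

lemma simple_injective : Function.Injective h.simple := fun _ _ hij =>
  h.linearIndependent_frameSimple.injective (congrArg Subtype.val hij)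

variable [FiniteDimensional ℝ V]

/-- The base of the root system of a frame. -/
def base : h.rootPairing.Base :=
  have := finite_frameRoots (ε := ε).to_subtype
  have := h.isReduced
  have := h.isRootSystem
  have := h.isCrystallographic
  RootPairing.Base.mk' h.rootPairing (Set.range h.simple)
    ((linearIndepOn_range_iff h.simple_injective _).2 h.linearIndependent_frameSimple)
    (fun v => by
      rw [← Set.range_comp]
      exact mem_or_neg_mem_closure_frameSimple v.2)

lemma mem_base_support {v : frameRoots ε} : v ∈ h.base.support ↔ v ∈ Set.range h.simple :=
  Set.Finite.mem_toFinset _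

end Base

theorem isRootSystemOfTypeC {n : ℕ} {ε : Fin n → V} {c : ℝ} (h : IsFrame ε c) :
    IsRootSystemOfTypeC n (frameRoots ε) := by
  have := Module.Basis.finiteDimensional_of_finite h.basis
  have := h.isCrystallographic
  refine ⟨finite_frameRoots, h.rootPairing, fun _ => rfl, h.isEuclidean, h.isRootSystem,
    h.isReduced, this, h.base, (Equiv.ofInjective _ h.simple_injective).trans
      (Equiv.subtypeEquivRight fun v => h.mem_base_support.symm), fun i j => ?_⟩
  rw [← Int.cast_inj (α := ℝ), ← h.frameSimple_pairing]
  refine (h.base.algebraMap_cartanMatrixIn_apply ℤ _ _).trans ?_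
  rw [h.rootPairing_pairing]
  rfl

end IsFrame

end RootPairing

/-! ### The frame of a root system of type `C` -/

section Similar

variable {V W κ : Type*} [NormedAddCommGroup V] [InnerProductSpace ℝ V] [NormedAddCommGroup W]
  [InnerProductSpace ℝ W]

lemma exists_inner_eq_mul_inner_of_pairing_eq {a : κ → V} {b : κ → W} (ha : ∀ i, a i ≠ 0)
    (hb : ∀ i, b i ≠ 0)
    (hconn : ∀ i j, Relation.ReflTransGen (fun i j => ⟪b i, b j⟫ ≠ 0) i j)
    (hab : ∀ i j, 2 * ⟪a i, a j⟫ / ⟪a j, a j⟫ = 2 * ⟪b i, b j⟫ / ⟪b j, b j⟫) :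
    ∃ k : ℝ, 0 < k ∧ ∀ i j, ⟪a i, a j⟫ = k * ⟪b i, b j⟫ := by
  let ratio (i : κ) : ℝ := ⟪a i, a i⟫ / ⟪b i, b i⟫
  have hinner : ∀ i j, ⟪a i, a j⟫ = ratio j * ⟪b i, b j⟫ := fun i j => by
    have haj : ⟪a j, a j⟫ ≠ 0 := inner_self_ne_zero.2 (ha j)
    have hbj : ⟪b j, b j⟫ ≠ 0 := inner_self_ne_zero.2 (hb j)
    have hab := hab i j
    simp only [ratio]
    field_simp at hab ⊢
    linarith
  have hratio : ∀ i j, ratio i = ratio j := fun i j => by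
    induction hconn i j with
    | refl => rfl
    | @tail j k _ hjk ih =>
      refine ih.trans (mul_right_cancel₀ hjk ?_)
      rw [← hinner, real_inner_comm (b k), ← hinner, real_inner_comm]
  rcases isEmpty_or_nonempty κ with hκ | ⟨⟨i₀⟩⟩
  · exact ⟨1, one_pos, fun i => hκ.elim i⟩
  · exact ⟨ratio i₀, div_pos (real_inner_self_pos.2 (ha i₀)) (real_inner_self_pos.2 (hb i₀)),
      fun i j => by rw [hinner, hratio]⟩

lemma inner_map_eq_mul_inner (v : Module.Basis κ ℝ V) {L : V →ₗ[ℝ] W} {k : ℝ}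
    (hL : ∀ i j, ⟪L (v i), L (v j)⟫ = k * ⟪v i, v j⟫) (x y : V) : ⟪L x, L y⟫ = k * ⟪x, y⟫ := by
  have hext : (innerₗ W).compl₁₂ L L = k • innerₗ V := LinearMap.ext_basis v v hL
  exact LinearMap.congr_fun₂ hext x y

lemma IsFrame.map {ε : κ → V} {c k : ℝ} (h : IsFrame ε c) (hk : 0 < k) {L : V →ₗ[ℝ] W}
    (hL : ∀ x y, ⟪L x, L y⟫ = k * ⟪x, y⟫) (hsurj : Function.Surjective L) :
    IsFrame (L ∘ ε) (k * c) where
  pos := mul_pos hk h.pos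
  inner_self i := by rw [Function.comp_apply, hL, h.inner_self]
  orthogonal hij := by rw [Function.comp_apply, Function.comp_apply, hL, h.orthogonal hij, mul_zero]
  span_eq_top := by
    rw [Set.range_comp, Submodule.span_image, h.span_eq_top, Submodule.map_top,
      LinearMap.range_eq_top.2 hsurj]

lemma isFrame_orthonormalBasis [Fintype κ] (v : OrthonormalBasis κ ℝ V) : IsFrame v 1 where
  pos := one_pos
  inner_self := v.inner_eq_one
  orthogonal := v.inner_eq_zero
  span_eq_top := by rw [← v.coe_toBasis, v.toBasis.span_eq]

lemma map_frameSimple {n : ℕ} (L : V →ₗ[ℝ] W) (ε : Fin n → V) (i : Fin n) :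
    L (frameSimple ε i) = frameSimple (L ∘ ε) i := by
  by_cases hi : i.1 + 1 < n
  · rw [frameSimple_of_lt hi, frameSimple_of_lt hi, map_sub, Function.comp_apply,
      Function.comp_apply]
  · rw [frameSimple_of_not_lt hi, frameSimple_of_not_lt hi, map_smul, Function.comp_apply]

lemma IsFrame.reflTransGen_inner_frameSimple {n : ℕ} {ε : Fin n → V} {c : ℝ} (h : IsFrame ε c)
    (i j : Fin n) :
    Relation.ReflTransGen (fun i j => ⟪frameSimple ε i, frameSimple ε j⟫ ≠ 0) i j := by
  have hnext : ∀ (i : Fin n) (hi : i.1 + 1 < n),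
      ⟪frameSimple ε i, frameSimple ε ⟨i.1 + 1, hi⟩⟫ ≠ 0 := fun i hi h0 => by
    have hpairing := h.frameSimple_pairing i ⟨i.1 + 1, hi⟩
    rw [h0] at hpairing
    simp [CartanMatrix.C, Fin.ext_iff] at hpairing
  have hle : ∀ i j : Fin n, i ≤ j →
      Relation.ReflTransGen (fun i j => ⟪frameSimple ε i, frameSimple ε j⟫ ≠ 0) i j := by
    rintro i ⟨j, hj⟩ (hij : i.1 ≤ j)
    induction j, hij using Nat.le_induction with
    | base => exact .refl
    | succ j _ ih => exact (ih (by lia)).tail (hnext ⟨j, by lia⟩ hj)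
  have : Std.Symm fun i j => ⟪frameSimple ε i, frameSimple ε j⟫ ≠ 0 :=
    ⟨fun i j hij => by rwa [real_inner_comm]⟩
  exact (le_total i j).elim (hle i j) fun hji => symm (hle j i hji)

end Similar

section ExistsFrame

variable {ι E : Type*} [NormedAddCommGroup E] [InnerProductSpace ℝ E] {P : RootPairing ι ℝ E E}

lemma pairing_eq_inner [IsEuclidean P] (i j : ι) :
    P.pairing i j = 2 * ⟪P.root i, P.root j⟫ / ⟪P.root j, P.root j⟫ := by
  change P.toLinearMap (P.root i) (P.coroot j) = _
  rw [IsEuclidean.pairing_eq, IsEuclidean.coroot_eq, inner_smul_right, mul_div_right_comm]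

lemma span_range_simple_root [P.IsRootSystem] (b : P.Base) {κ : Type*} (e : κ ≃ b.support) :
    Submodule.span ℝ (Set.range fun i => P.root (e i)) = ⊤ := by
  rw [← RootPairing.IsRootSystem.span_root_eq_top (P := P), ← RootPairing.rootSpan,
    ← b.span_root_support, ← Subtype.range_coe (s := (b.support : Set ι)), ← Set.range_comp]
  exact congrArg _ (e.surjective.range_comp fun i : b.support => P.root i)

/-- The simple roots have the same Cartan numbers as those of the standard frame, so the linear map
matching the two is a similarity and carries the standard frame to the desired one. -/
theorem exists_isFrame [IsEuclidean P] [P.IsRootSystem] [P.IsCrystallographic] {b : P.Base} {n : ℕ}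
    {e : Fin n ≃ b.support} (he : IsTypeCLabelling b e) :
    ∃ (ε : Fin n → E) (c : ℝ), IsFrame ε c ∧ ∀ i, P.root (e i) = frameSimple ε i := by
  have hδ := isFrame_orthonormalBasis (EuclideanSpace.basisFun (Fin n) ℝ)
  obtain ⟨k, hk, hinner⟩ := exists_inner_eq_mul_inner_of_pairing_eq
    (a := fun i => P.root (e i)) (fun i => P.ne_zero _)
    (fun i => (hδ.frameSimple_mem i).1) hδ.reflTransGen_inner_frameSimple fun i j => by
      rw [← pairing_eq_inner, hδ.frameSimple_pairing, ← he]
      exact (b.algebraMap_cartanMatrixIn_apply ℤ _ _).symm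
  let v := Module.Basis.mk hδ.linearIndependent_frameSimple hδ.span_frameSimple.ge
  have hv : ∀ i, v i = frameSimple _ i := Module.Basis.mk_apply _ _
  let L := v.constr ℝ fun i => P.root (e i)
  have hL : ∀ i, L (v i) = P.root (e i) := v.constr_basis ℝ _
  refine ⟨_, _, hδ.map hk (L := L) (inner_map_eq_mul_inner v fun i j => ?_) ?_, fun i => ?_⟩
  · rw [hL, hL, hinner, hv, hv]
  · rw [← LinearMap.range_eq_top, v.constr_range, span_range_simple_root]
  · rw [← map_frameSimple, ← hv, hL]

end ExistsFrame

/-! ### Word length and inversions -/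

section Words

variable {G : Type*} [Group G] {S : Set G}

lemma wordLength_le {l : List G} (hl : ∀ s ∈ l, s ∈ S) : wordLength S l.prod ≤ l.length :=
  Nat.sInf_le ⟨l, hl, rfl, rfl⟩

lemma exists_word (hS : ∀ s ∈ S, s * s = 1) {w : G} (hw : w ∈ Subgroup.closure S) :
    ∃ l : List G, (∀ s ∈ l, s ∈ S) ∧ l.prod = w ∧ l.length = wordLength S w := by
  refine Nat.sInf_mem (s := {n | ∃ l : List G, (∀ s ∈ l, s ∈ S) ∧ l.prod = w ∧ l.length = n}) ?_
  have hinv : S⁻¹ ⊆ S := fun s hs => by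
    rwa [← inv_inv s, inv_eq_of_mul_eq_one_left (hS _ hs)]
  rw [← Subgroup.mem_toSubmonoid, Subgroup.closure_toSubmonoid, Set.union_eq_left.2 hinv] at hw
  obtain ⟨l, hl, hlw⟩ := Submonoid.exists_list_of_mem_closure hw
  exact ⟨_, l, hl, hlw, rfl⟩

lemma wordLength_one : wordLength S 1 = 0 :=
  Nat.le_zero.1 (wordLength_le (l := []) (List.forall_mem_nil _))

lemma eq_one_of_wordLength_eq_zero (hS : ∀ s ∈ S, s * s = 1) {w : G}
    (hw : w ∈ Subgroup.closure S) (h : wordLength S w = 0) : w = 1 := by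
  obtain ⟨l, -, rfl, hlength⟩ := exists_word hS hw
  rw [List.length_eq_zero_iff.1 (hlength.trans h), List.prod_nil]

lemma wordLength_mul_le (hS : ∀ s ∈ S, s * s = 1) {w s : G} (hw : w ∈ Subgroup.closure S)
    (hs : s ∈ S) : wordLength S (w * s) ≤ wordLength S w + 1 := by
  obtain ⟨l, hl, rfl, hlength⟩ := exists_word hS hw
  have hle := wordLength_le
    (List.forall_mem_append.2 ⟨hl, (List.forall_mem_singleton (p := (· ∈ S))).2 hs⟩)
  rwa [List.prod_append, List.prod_singleton, List.length_append, List.length_singleton, hlength]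
    at hle

end Words

section WeylGroup

variable {ι E : Type*} [NormedAddCommGroup E] [InnerProductSpace ℝ E] {P : RootPairing ι ℝ E E}

lemma weylGroup_ext {g g' : P.weylGroup} (h : ∀ x : E, g • x = g' • x) : g = g' :=
  Subtype.ext (RootPairing.Equiv.weightHom_injective P (LinearEquiv.ext h))

lemma ofIdx_mul_self (i : ι) :
    RootPairing.weylGroup.ofIdx P i * RootPairing.weylGroup.ofIdx P i = 1 :=
  weylGroup_ext fun x => P.reflection_same i x

lemma mul_self_of_mem_simpleReflections {I : Set ι} {s : P.weylGroup}
    (hs : s ∈ simpleReflections I) : s * s = 1 := by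
  obtain ⟨i, -, rfl⟩ := hs
  exact ofIdx_mul_self i

lemma ofIdx_smul_eq_inner [IsEuclidean P] (i : ι) (x : E) :
    RootPairing.weylGroup.ofIdx P i • x =
      x - (2 * ⟪P.root i, x⟫ / ⟪P.root i, P.root i⟫) • P.root i := by
  rw [RootPairing.weylGroup.ofIdx_smul, RootPairing.Equiv.reflection_smul, P.reflection_apply]
  change x - P.toLinearMap x (P.coroot i) • P.root i = _
  rw [IsEuclidean.pairing_eq, IsEuclidean.coroot_eq, inner_smul_right, real_inner_comm x,
    mul_div_right_comm]

lemma mul_ofIdx_eq_ofIdx_mul [IsEuclidean P] {g : P.weylGroup} {i j : ι}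
    (hij : P.weylGroupToPerm g i = j) :
    g * RootPairing.weylGroup.ofIdx P i = RootPairing.weylGroup.ofIdx P j * g := by
  refine weylGroup_ext fun x => ?_
  rw [mul_smul, mul_smul, ofIdx_smul_eq_inner, ofIdx_smul_eq_inner, ← hij,
    ← P.weylGroup_apply_root, inner_weyl_smul, inner_weyl_smul, smul_sub, smul_comm g]

lemma weylGroupToPerm_reflectionPerm_self (g : P.weylGroup) (i : ι) :
    P.weylGroupToPerm g (P.reflectionPerm i i) =
      P.reflectionPerm (P.weylGroupToPerm g i) (P.weylGroupToPerm g i) := by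
  apply P.root.injective
  rw [← P.weylGroup_apply_root, P.root_reflectionPerm, P.root_reflectionPerm,
    P.reflection_apply_self, P.reflection_apply_self, smul_neg, P.weylGroup_apply_root]

lemma weylGroupToPerm_ofIdx (i : ι) :
    P.weylGroupToPerm (RootPairing.weylGroup.ofIdx P i) = P.reflectionPerm i := rfl

section Inversions

variable {b : P.Base} {I : Set ι} {g g' : P.weylGroup} {i : ι}

/-- The inversions of a Weyl group element: (the indices of) the positive roots that it makes
negative. -/
def inversions (b : P.Base) (g : P.weylGroup) : Set ι :=
  {i | b.IsPos i ∧ ¬ b.IsPos (P.weylGroupToPerm g i)}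

lemma inversions_one : inversions b 1 = ∅ := by
  ext i
  simp only [inversions, map_one, Equiv.Perm.one_apply, and_not_self_iff, Set.mem_ofPred_eq,
    Set.mem_empty_iff_false]

lemma isPos_reflectionPerm_self_iff : b.IsPos (P.reflectionPerm i i) ↔ ¬ b.IsPos i :=
  RootPairing.Base.IsPos.neg_iff_not b i

lemma mem_inversions_mul_ofIdx_self (hi : i ∈ b.support) :
    i ∈ inversions b (g * RootPairing.weylGroup.ofIdx P i) ↔ i ∉ inversions b g := by
  have hpos := RootPairing.Base.isPos_of_mem_support hi
  simp only [inversions, Set.mem_ofPred_eq, hpos, true_and, map_mul, Equiv.Perm.mul_apply,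
    weylGroupToPerm_ofIdx, weylGroupToPerm_reflectionPerm_self, isPos_reflectionPerm_self_iff]

variable [Finite ι] [P.IsReduced] [P.IsCrystallographic]

/-- A simple reflection permutes the positive roots other than its own. -/
lemma reflectionPerm_mem_inversions (hi : i ∈ b.support) {j : ι} (hji : j ≠ i)
    (hj : j ∈ inversions b (g * RootPairing.weylGroup.ofIdx P i)) :
    P.reflectionPerm i j ∈ inversions b g :=
  ⟨hj.1.reflectionPerm hi hji, hj.2⟩

lemma ncard_inversions_mul_sdiff_le (hi : i ∈ b.support) :
    (inversions b (g * RootPairing.weylGroup.ofIdx P i) \ {i}).ncard ≤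
      (inversions b g \ {i}).ncard := by
  rw [← Set.ncard_image_of_injective _ (P.reflectionPerm i).injective]
  refine Set.ncard_le_ncard ?_ (Set.toFinite _)
  rintro _ ⟨j, ⟨hj, hji⟩, rfl⟩
  refine ⟨reflectionPerm_mem_inversions hi hji hj, fun hself => ?_⟩
  have hneg : P.reflectionPerm i i = j :=
    (congrArg (P.reflectionPerm i) hself.symm).trans (P.reflectionPerm_self i j)
  rw [← hneg] at hj
  exact isPos_reflectionPerm_self_iff.1 hj.1 (RootPairing.Base.isPos_of_mem_support hi)

lemma ncard_inversions_mul_ofIdx_add_one (hi : i ∈ inversions b g) (hib : i ∈ b.support) :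
    (inversions b (g * RootPairing.weylGroup.ofIdx P i)).ncard + 1 = (inversions b g).ncard := by
  have hle := ncard_inversions_mul_sdiff_le (g := g) hib
  have hge := ncard_inversions_mul_sdiff_le (g := g * RootPairing.weylGroup.ofIdx P i) hib
  rw [mul_assoc, ofIdx_mul_self, mul_one] at hge
  rw [← Set.ncard_sdiff_singleton_add_one hi (Set.toFinite _), hge.antisymm hle,
    Set.sdiff_singleton_eq_self fun h => (mem_inversions_mul_ofIdx_self hib).1 h hi]

lemma exchange_condition [IsEuclidean P] (hI : I ⊆ b.support) {l : List P.weylGroup}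
    (hl : ∀ s ∈ l, s ∈ simpleReflections I) (hi : i ∈ inversions b l.prod) :
    ∃ l' : List P.weylGroup, (∀ s ∈ l', s ∈ simpleReflections I) ∧
      l'.prod = l.prod * RootPairing.weylGroup.ofIdx P i ∧ l'.length + 1 = l.length := by
  induction l with
  | nil => simp [inversions_one] at hi
  | cons s t ih =>
    obtain ⟨hs, ht⟩ := List.forall_mem_cons.1 hl
    by_cases hit : i ∈ inversions b t.prod
    · obtain ⟨t', ht', hprod, hlength⟩ := ih ht hit
      exact ⟨s :: t', List.forall_mem_cons.2 ⟨hs, ht'⟩,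
        by rw [List.prod_cons, List.prod_cons, hprod, mul_assoc], congrArg (· + 1) hlength⟩
    · obtain ⟨j, hj, rfl⟩ := hs
      rw [List.prod_cons, inversions, Set.mem_ofPred_eq, map_mul, Equiv.Perm.mul_apply] at hi
      have hpos : b.IsPos (P.weylGroupToPerm t.prod i) := not_not.1 fun h => hit ⟨hi.1, h⟩
      have hij : P.weylGroupToPerm t.prod i = j := by
        by_contra hne
        exact hi.2 (hpos.reflectionPerm (hI hj) hne)
      refine ⟨t, ht, ?_, rfl⟩
      rw [List.prod_cons, mul_assoc, mul_ofIdx_eq_ofIdx_mul hij, ← mul_assoc, ofIdx_mul_self,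
        one_mul]

lemma wordLength_mul_ofIdx_add_one [IsEuclidean P] (hI : I ⊆ b.support)
    (hg : g ∈ Subgroup.closure (simpleReflections I)) (hiI : i ∈ I) (hi : i ∈ inversions b g) :
    wordLength (simpleReflections I) (g * RootPairing.weylGroup.ofIdx P i) + 1 =
      wordLength (simpleReflections I) g := by
  have hs : RootPairing.weylGroup.ofIdx P i ∈ simpleReflections I := ⟨i, hiI, rfl⟩
  refine le_antisymm ?_ ?_
  · obtain ⟨l, hl, rfl, hlength⟩ := exists_word (fun _ => mul_self_of_mem_simpleReflections) hg
    obtain ⟨l', hl', hprod, hlength'⟩ := exchange_condition hI hl hi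
    rw [← hprod, ← hlength, ← hlength']
    exact Nat.succ_le_succ (wordLength_le hl')
  · conv_lhs => rw [← mul_one g, ← ofIdx_mul_self i, ← mul_assoc]
    exact wordLength_mul_le (fun _ => mul_self_of_mem_simpleReflections)
      (mul_mem hg (Subgroup.subset_closure hs)) hs

theorem ncard_inversions_eq_wordLength [IsEuclidean P] (hI : I ⊆ b.support)
    (hg : g ∈ Subgroup.closure (simpleReflections I)) :
    (inversions b g).ncard = wordLength (simpleReflections I) g := by
  have hmul : ∀ g ∈ Subgroup.closure (simpleReflections I), ∀ i ∈ I,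
      (inversions b g).ncard = wordLength (simpleReflections I) g →
      (inversions b (g * RootPairing.weylGroup.ofIdx P i)).ncard =
        wordLength (simpleReflections I) (g * RootPairing.weylGroup.ofIdx P i) := by
    intro g hg i hiI ih
    by_cases hi : i ∈ inversions b g
    · have hncard := ncard_inversions_mul_ofIdx_add_one hi (hI hiI)
      have hlength := wordLength_mul_ofIdx_add_one hI hg hiI hi
      lia
    · rw [← mem_inversions_mul_ofIdx_self (hI hiI)] at hi
      have hncard := ncard_inversions_mul_ofIdx_add_one hi (hI hiI)
      have hlength := wordLength_mul_ofIdx_add_one hI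
        (mul_mem hg (Subgroup.subset_closure ⟨i, hiI, rfl⟩)) hiI hi
      rw [mul_assoc, ofIdx_mul_self, mul_one] at hncard hlength
      lia
  induction hg using Subgroup.closure_induction_right with
  | one => rw [inversions_one, Set.ncard_empty, wordLength_one]
  | mul_right g hg s hs ih =>
    obtain ⟨i, hiI, rfl⟩ := hs
    exact hmul g hg i hiI ih
  | mul_inv_cancel g hg s hs ih =>
    rw [inv_eq_of_mul_eq_one_left (mul_self_of_mem_simpleReflections hs)]
    obtain ⟨i, hiI, rfl⟩ := hs
    exact hmul g hg i hiI ih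

lemma eq_of_inversions_eq [IsEuclidean P] (hI : I ⊆ b.support)
    (hg : g ∈ Subgroup.closure (simpleReflections I))
    (hg' : g' ∈ Subgroup.closure (simpleReflections I)) (h : inversions b g = inversions b g') :
    g = g' := by
  rw [← mul_inv_eq_one]
  have hmem := mul_mem hg (inv_mem hg')
  refine eq_one_of_wordLength_eq_zero (fun _ => mul_self_of_mem_simpleReflections) hmem ?_
  rw [← ncard_inversions_eq_wordLength hI hmem, Set.ncard_eq_zero]
  ext i
  obtain ⟨j, rfl⟩ := (P.weylGroupToPerm g').surjective i
  have hj : j ∈ inversions b g ↔ j ∈ inversions b g' := by rw [h]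
  have hj' : P.reflectionPerm j j ∈ inversions b g ↔ P.reflectionPerm j j ∈ inversions b g' := by
    rw [h]
  simp only [inversions, Set.mem_ofPred_eq, weylGroupToPerm_reflectionPerm_self,
    isPos_reflectionPerm_self_iff] at hj hj'
  simp only [inversions, Set.mem_ofPred_eq, ← Equiv.Perm.mul_apply, ← map_mul,
    inv_mul_cancel_right, Set.mem_empty_iff_false]
  tauto

/-- A word in the reflections of `I` adds multiples of roots of `I` to each vector, and it takes a
positive root to a negative one in some step, which must then be the reflection in that root. -/
lemma root_mem_span_of_mem_inversions (hI : I ⊆ b.support)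
    (hg : g ∈ Subgroup.closure (simpleReflections I)) (hi : i ∈ inversions b g) :
    P.root i ∈ Submodule.span ℝ (P.root '' I) := by
  have hmul : ∀ (g : P.weylGroup), ∀ j ∈ I,
      (∀ i ∈ inversions b g, P.root i ∈ Submodule.span ℝ (P.root '' I)) →
      ∀ i ∈ inversions b (g * RootPairing.weylGroup.ofIdx P j),
        P.root i ∈ Submodule.span ℝ (P.root '' I) := by
    intro g j hj ih i hi
    have hroot : P.root j ∈ Submodule.span ℝ (P.root '' I) := Submodule.subset_span ⟨j, hj, rfl⟩
    rcases eq_or_ne i j with rfl | hij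
    · exact hroot
    · have hmem := ih _ (reflectionPerm_mem_inversions (hI hj) hij hi)
      rw [P.root_reflectionPerm, P.reflection_apply] at hmem
      simpa only [sub_add_cancel] using
        add_mem hmem (Submodule.smul_mem _ (P.coroot' j (P.root i)) hroot)
  induction hg using Subgroup.closure_induction_right generalizing i with
  | one => simp [inversions_one] at hi
  | mul_right g _ s hs ih =>
    obtain ⟨j, hj, rfl⟩ := hs
    exact hmul g j hj (fun _ => ih) i hi
  | mul_inv_cancel g _ s hs ih =>
    rw [inv_eq_of_mul_eq_one_left (mul_self_of_mem_simpleReflections hs)] at hi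
    obtain ⟨j, hj, rfl⟩ := hs
    exact hmul g j hj (fun _ => ih) i hi

end Inversions

section LongestElement

variable [P.IsRootSystem] {b : P.Base} {I : Set ι}

/-- The linear functional extending the height. -/
def heightFunctional (b : P.Base) : E →ₗ[ℝ] ℝ :=
  b.toWeightBasis.constr ℝ fun _ => (1 : ℝ)

lemma heightFunctional_of_mem_support {i : ι} (hi : i ∈ b.support) :
    heightFunctional b (P.root i) = 1 := by
  have hbasis := b.toWeightBasis.constr_basis ℝ (fun _ => (1 : ℝ)) ⟨i, hi⟩
  rwa [b.toWeightBasis_apply] at hbasis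

lemma heightFunctional_root (i : ι) : heightFunctional b (P.root i) = b.height i := by
  obtain ⟨f, -, -, hf⟩ := b.exists_root_eq_sum_int i
  rw [RootPairing.Base.height_eq_sum hf, hf, map_sum, Int.cast_sum]
  refine Finset.sum_congr rfl fun j hj => ?_
  rw [map_zsmul, heightFunctional_of_mem_support hj, zsmul_eq_mul, mul_one]

lemma isPos_iff_heightFunctional_pos {i : ι} :
    b.IsPos i ↔ 0 < heightFunctional b (P.root i) := by
  rw [heightFunctional_root, RootPairing.Base.isPos_iff, Int.cast_pos]

lemma mem_inversions_of_mem_span (hI : I ⊆ b.support) {w : P.weylGroup}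
    (hw : ∀ i ∈ I, ∃ j ∈ b.support, w • P.root i = -P.root j) {i : ι} (hi : b.IsPos i)
    (hspan : P.root i ∈ Submodule.span ℝ (P.root '' I)) : i ∈ inversions b w := by
  have hheight : ∀ x ∈ Submodule.span ℝ (P.root '' I),
      heightFunctional b (w • x) = -heightFunctional b x := by
    intro x hx
    induction hx using Submodule.span_induction with
    | mem x hx =>
      obtain ⟨i, hi, rfl⟩ := hx
      obtain ⟨j, hj, hij⟩ := hw i hi
      rw [hij, map_neg, heightFunctional_of_mem_support hj, heightFunctional_of_mem_support (hI hi)]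
    | zero => rw [smul_zero, map_zero, neg_zero]
    | add x y _ _ hx hy => rw [smul_add, map_add, map_add, hx, hy, neg_add]
    | smul t x _ hx => rw [smul_comm w t x, LinearMap.map_smul, LinearMap.map_smul, hx, smul_neg]
  refine ⟨hi, ?_⟩
  rw [isPos_iff_heightFunctional_pos] at hi ⊢
  rw [← P.weylGroup_apply_root, hheight _ hspan]
  linarith

/-- Such a `w` has every positive root in the span of `I` as an inversion, and an element of the
parabolic subgroup has no other inversions. -/
theorem longestElement_simpleReflections [Finite ι] [P.IsReduced] [P.IsCrystallographic]
    [IsEuclidean P] (hI : I ⊆ b.support) {w : P.weylGroup}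
    (hw : w ∈ Subgroup.closure (simpleReflections I))
    (hwI : ∀ i ∈ I, ∃ j ∈ b.support, w • P.root i = -P.root j) :
    longestElement (simpleReflections I) = w := by
  have hsubset : ∀ g ∈ Subgroup.closure (simpleReflections I), inversions b g ⊆ inversions b w :=
    fun g hg i hi =>
      mem_inversions_of_mem_span hI hwI hi.1 (root_mem_span_of_mem_inversions hI hg hi)
  have hlongest : IsLongest (simpleReflections I) w := ⟨hw, fun g hg => by
    rw [← ncard_inversions_eq_wordLength hI hg, ← ncard_inversions_eq_wordLength hI hw]
    exact Set.ncard_le_ncard (hsubset g hg) (Set.toFinite _)⟩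
  obtain ⟨hg, hmax⟩ : IsLongest (simpleReflections I) (longestElement (simpleReflections I)) :=
    Classical.epsilon_spec ⟨w, hlongest⟩
  refine eq_of_inversions_eq hI hg hw
    (Set.eq_of_subset_of_ncard_le (hsubset _ hg) ?_ (Set.toFinite _))
  rw [ncard_inversions_eq_wordLength hI hg, ncard_inversions_eq_wordLength hI hw]
  exact hmax w hw

end LongestElement

end WeylGroup

/-! ### The Weyl group of type `C` -/

section SimpleReflections

variable {ι E : Type*} [NormedAddCommGroup E] [InnerProductSpace ℝ E] {P : RootPairing ι ℝ E E}
  [IsEuclidean P]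

lemma ofIdx_mem_closure_simpleReflections [Finite ι] [P.IsReduced] [P.IsCrystallographic]
    (b : P.Base) (i : ι) :
    RootPairing.weylGroup.ofIdx P i ∈ Subgroup.closure (simpleReflections b.support) := by
  have hconj : ∀ i j : ι,
      RootPairing.weylGroup.ofIdx P i ∈ Subgroup.closure (simpleReflections b.support) →
      RootPairing.weylGroup.ofIdx P j ∈ Subgroup.closure (simpleReflections b.support) →
      RootPairing.weylGroup.ofIdx P (P.reflectionPerm j i) ∈
        Subgroup.closure (simpleReflections b.support) := fun i j hi hj => by
    have hcomm : RootPairing.weylGroup.ofIdx P j * RootPairing.weylGroup.ofIdx P i =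
        RootPairing.weylGroup.ofIdx P (P.reflectionPerm j i) * RootPairing.weylGroup.ofIdx P j :=
      mul_ofIdx_eq_ofIdx_mul rfl
    rw [eq_mul_inv_of_mul_eq hcomm.symm]
    exact mul_mem (mul_mem hj hi) (inv_mem hj)
  have hsimple : ∀ i ∈ b.support,
      RootPairing.weylGroup.ofIdx P i ∈ Subgroup.closure (simpleReflections b.support) :=
    fun i hi => Subgroup.subset_closure ⟨i, hi, rfl⟩
  exact b.induction_reflect i (fun i hi => hconj i i hi hi) hsimple
    fun i j hi hj => hconj i j hi (hsimple j hj)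

lemma closure_simpleReflections [Finite ι] [P.IsReduced] [P.IsCrystallographic] (b : P.Base) :
    (Subgroup.closure (simpleReflections b.support) : Subgroup P.weylGroup) = ⊤ := by
  rw [Subgroup.eq_top_iff']
  rintro ⟨g, hg⟩
  induction hg using RootPairing.weylGroup.induction with
  | mem i => exact ofIdx_mem_closure_simpleReflections b i
  | one => exact one_mem _
  | mul g g' _ _ hg hg' => exact mul_mem hg hg'

lemma sub_mem_range_root {v w : E} (hv : v ∈ Set.range P.root) (hw : w ∈ Set.range P.root) :
    w - (2 * ⟪v, w⟫ / ⟪v, v⟫) • v ∈ Set.range P.root := by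
  obtain ⟨i, rfl⟩ := hv
  obtain ⟨j, rfl⟩ := hw
  rw [← ofIdx_smul_eq_inner, P.weylGroup_apply_root]
  exact Set.mem_range_self _

lemma range_root_subset [Finite ι] [P.IsReduced] [P.IsCrystallographic] {Φ : Set E}
    (hΦ : ∀ v ∈ Φ, ∀ w ∈ Φ, w - (2 * ⟪v, w⟫ / ⟪v, v⟫) • v ∈ Φ) (b : P.Base)
    (hb : ∀ i ∈ b.support, P.root i ∈ Φ) : Set.range P.root ⊆ Φ := by
  have hreflection : ∀ i j, P.root i ∈ Φ → P.root j ∈ Φ → P.root (P.reflectionPerm j i) ∈ Φ :=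
    fun i j hi hj => by
      rw [← weylGroupToPerm_ofIdx, ← P.weylGroup_apply_root, ofIdx_smul_eq_inner]
      exact hΦ _ hj _ hi
  rintro _ ⟨i, rfl⟩
  exact b.induction_reflect i (fun i hi => hreflection i i hi hi) hb
    fun i j hi hj => hreflection i j hi (hb j hj)

end SimpleReflections

section WeylC

variable {ι E : Type*} [NormedAddCommGroup E] [InnerProductSpace ℝ E] {P : RootPairing ι ℝ E E}

lemma support_sdiff_last {b : P.Base} {n : ℕ} (e : Fin (n + 1) ≃ b.support) :
    (b.support : Set ι) \ {(e (Fin.last n) : ι)} =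
      Set.range fun i : Fin n => (e i.castSucc : ι) := by
  ext a
  constructor
  · rintro ⟨ha, hlast⟩
    obtain ⟨i, hi⟩ := e.surjective ⟨a, ha⟩
    obtain rfl : (e i : ι) = a := congrArg Subtype.val hi
    obtain ⟨j, rfl⟩ := Fin.exists_castSucc_eq.2 fun hi : i = Fin.last n => hlast (hi ▸ rfl)
    exact ⟨j, rfl⟩
  · rintro ⟨i, rfl⟩
    exact ⟨(e _).2, fun hi => (Fin.castSucc_lt_last i).ne (e.injective (Subtype.ext hi))⟩

lemma frameSimple_castSucc {n : ℕ} (ε : Fin (n + 1) → E) (i : Fin n) :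
    frameSimple ε i.castSucc = ε i.castSucc - ε i.succ :=
  frameSimple_of_lt (Nat.succ_lt_succ i.2)

variable [IsEuclidean P]

namespace IsFrame

variable {κ : Type*} {ε : κ → E} {c : ℝ}

lemma inner_sub_self (h : IsFrame ε c) {i j : κ} (hij : i ≠ j) :
    ⟪ε i - ε j, ε i - ε j⟫ = 2 * c := by
  rw [inner_sub_left, inner_sub_right, inner_sub_right, h.inner_self, h.inner_self,
    h.orthogonal hij, h.orthogonal hij.symm]
  ring

lemma ofIdx_smul_of_root_eq_sub [DecidableEq κ] (h : IsFrame ε c) {a : ι} {i j : κ} (hij : i ≠ j)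
    (ha : P.root a = ε i - ε j) (k : κ) :
    RootPairing.weylGroup.ofIdx P a • ε k = ε (Equiv.swap i j k) := by
  have hc := h.pos.ne'
  rw [ofIdx_smul_eq_inner, ha, h.inner_sub_self hij, inner_sub_left]
  rcases eq_or_ne k i with rfl | hki
  · rw [h.inner_self, h.orthogonal hij.symm, Equiv.swap_apply_left, sub_zero,
      div_self (by simpa), one_smul, sub_sub_cancel]
  rcases eq_or_ne k j with rfl | hkj
  · rw [h.inner_self, h.orthogonal hij, Equiv.swap_apply_right, zero_sub, mul_neg, neg_div,
      div_self (by simpa), neg_one_smul, sub_neg_eq_add, add_sub_cancel]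
  rw [h.orthogonal hki.symm, h.orthogonal hkj.symm, Equiv.swap_apply_of_ne_of_ne hki hkj, sub_zero,
    mul_zero, zero_div, zero_smul, sub_zero]

lemma ofIdx_smul_self_of_root_eq_two_smul (h : IsFrame ε c) {a : ι} {i : κ}
    (ha : P.root a = (2 : ℝ) • ε i) : RootPairing.weylGroup.ofIdx P a • ε i = -ε i := by
  have hc := h.pos.ne'
  rw [ofIdx_smul_eq_inner, ha, inner_smul_left, inner_smul_left, inner_smul_right, h.inner_self,
    RCLike.conj_to_real, smul_smul, show 2 * (2 * c) / (2 * (2 * c)) * 2 = 2 by field_simp]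
  module

lemma ofIdx_smul_of_root_eq_two_smul (h : IsFrame ε c) {a : ι} {i j : κ}
    (ha : P.root a = (2 : ℝ) • ε i) (hij : i ≠ j) :
    RootPairing.weylGroup.ofIdx P a • ε j = ε j := by
  rw [ofIdx_smul_eq_inner, ha, inner_smul_left, h.orthogonal hij, mul_zero, mul_zero, zero_div,
    zero_smul, sub_zero]

lemma exists_smul_eq_neg [Finite κ] (h : IsFrame ε c) (hP : Set.range P.root = frameRoots ε) :
    ∃ w : P.weylGroup, ∀ x : E, w • x = -x := by
  classical
  have := Fintype.ofFinite κ
  suffices ∀ s : Finset κ, ∃ w : P.weylGroup,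
      (∀ i ∈ s, w • ε i = -ε i) ∧ ∀ i ∉ s, w • ε i = ε i by
    obtain ⟨w, hw, -⟩ := this Finset.univ
    have hext : DistribSMul.toLinearMap ℝ E w = -LinearMap.id :=
      LinearMap.ext_on_range h.span_eq_top fun i => hw i (Finset.mem_univ i)
    exact ⟨w, LinearMap.congr_fun hext⟩
  intro s
  induction s using Finset.induction_on with
  | empty => exact ⟨1, fun i hi => absurd hi (Finset.notMem_empty i), fun i _ => one_smul _ _⟩
  | insert j s hj ih =>
    obtain ⟨w, hneg, hfix⟩ := ih
    obtain ⟨a, ha⟩ : (2 : ℝ) • ε j ∈ Set.range P.root := hP ▸ h.two_smul_mem_frameRoots j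
    refine ⟨RootPairing.weylGroup.ofIdx P a * w, fun i hi => ?_, fun i hi => ?_⟩
    · rcases Finset.mem_insert.1 hi with rfl | hi
      · rw [mul_smul, hfix _ hj, h.ofIdx_smul_self_of_root_eq_two_smul ha]
      · rw [mul_smul, hneg i hi, smul_neg,
          h.ofIdx_smul_of_root_eq_two_smul ha (ne_of_mem_of_not_mem hi hj).symm]
    · obtain ⟨hij, hi⟩ := not_or.1 (Finset.mem_insert.not.1 hi)
      rw [mul_smul, hfix i hi, h.ofIdx_smul_of_root_eq_two_smul ha (Ne.symm hij)]

end IsFrame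

namespace IsFrame

variable {b : P.Base} {n : ℕ} {e : Fin (n + 1) ≃ b.support} {ε : Fin (n + 1) → E} {c : ℝ}

lemma exists_smul_eq_perm (h : IsFrame ε c) (he : ∀ i, P.root (e i) = frameSimple ε i)
    (π : Equiv.Perm (Fin (n + 1))) :
    ∃ w ∈ Subgroup.closure (simpleReflections ((b.support : Set ι) \ {(e (Fin.last n) : ι)})),
      ∀ i, (w : P.weylGroup) • ε i = ε (π i) := by
  have hπ : π ∈ Submonoid.closure (Set.range fun i : Fin n => Equiv.swap i.castSucc i.succ) := by
    rw [Equiv.Perm.mclosure_swap_castSucc_succ]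
    exact Submonoid.mem_top π
  induction hπ using Submonoid.closure_induction with
  | mem π hπ =>
    obtain ⟨i, rfl⟩ := hπ
    refine ⟨_, Subgroup.subset_closure ⟨_, support_sdiff_last e ▸ Set.mem_range_self i, rfl⟩,
      h.ofIdx_smul_of_root_eq_sub (Fin.castSucc_lt_succ).ne ?_⟩
    rw [he, frameSimple_castSucc]
  | one => exact ⟨1, one_mem _, fun i => one_smul _ _⟩
  | mul π σ _ _ hπ hσ =>
    obtain ⟨w, hw, hwπ⟩ := hπ
    obtain ⟨v, hv, hvσ⟩ := hσ
    exact ⟨w * v, mul_mem hw hv, fun i => by rw [mul_smul, hvσ, hwπ, Equiv.Perm.mul_apply]⟩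

variable [Finite ι] [P.IsRootSystem] [P.IsReduced] [P.IsCrystallographic]

lemma longestElement_sdiff_last_smul (h : IsFrame ε c)
    (he : ∀ i, P.root (e i) = frameSimple ε i) (i : Fin (n + 1)) :
    (longestElement (simpleReflections ((b.support : Set ι) \ {(e (Fin.last n) : ι)})) :
      P.weylGroup) • ε i = ε i.rev := by
  obtain ⟨w, hw, hwε⟩ := h.exists_smul_eq_perm he Fin.revPerm
  rw [longestElement_simpleReflections Set.sdiff_subset hw, hwε, Fin.revPerm_apply]
  rw [support_sdiff_last]
  rintro _ ⟨j, rfl⟩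
  refine ⟨e j.rev.castSucc, (e _).2, ?_⟩
  rw [he, he, frameSimple_castSucc, frameSimple_castSucc, smul_sub, hwε, hwε, neg_sub,
    Fin.revPerm_apply, Fin.revPerm_apply, Fin.rev_castSucc, Fin.rev_succ]

end IsFrame

end WeylC

section WeylC

variable {ι E : Type*} [NormedAddCommGroup E] [InnerProductSpace ℝ E] [Finite ι]
  {P : RootPairing ι ℝ E E} [IsEuclidean P] [P.IsReduced] [P.IsCrystallographic]
  {b : P.Base} {l : ℕ} {e : Fin l ≃ b.support} {ε : Fin l → E} {c : ℝ}

namespace IsFrame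

lemma range_root_eq (h : IsFrame ε c) (he : ∀ i, P.root (e i) = frameSimple ε i) :
    Set.range P.root = frameRoots ε := by
  have := Module.Basis.finiteDimensional_of_finite h.basis
  have := finite_frameRoots (ε := ε).to_subtype
  have := h.isEuclidean
  have := h.isReduced
  have := h.isCrystallographic
  refine (range_root_subset (fun v hv w hw => h.reflection_mem_frameRoots hv hw) b
    fun a ha => ?_).antisymm ?_
  · obtain ⟨i, hi⟩ := e.surjective ⟨a, ha⟩
    obtain rfl : (e i : ι) = a := congrArg Subtype.val hi
    exact he i ▸ h.frameSimple_mem i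
  · have hrange : Set.range h.rootPairing.root = frameRoots ε := Subtype.range_coe
    rw [← hrange]
    refine range_root_subset (fun v hv w hw => sub_mem_range_root hv hw) h.base fun a ha => ?_
    obtain ⟨i, rfl⟩ := h.mem_base_support.1 ha
    exact ⟨e i, he i⟩

variable [P.IsRootSystem]

lemma longestElement_smul (h : IsFrame ε c) (he : ∀ i, P.root (e i) = frameSimple ε i) (x : E) :
    (longestElement (simpleReflections b.support) : P.weylGroup) • x = -x := by
  obtain ⟨w, hw⟩ := h.exists_smul_eq_neg (h.range_root_eq he)
  rw [longestElement_simpleReflections subset_rfl (closure_simpleReflections b ▸ Subgroup.mem_top w)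
    fun i hi => ⟨i, hi, hw _⟩, hw]

lemma omega_smul (h : IsFrame ε c) (he : ∀ i, P.root (e i) = frameSimple ε i) (hl : 0 < l)
    (i : Fin l) : omega b (e ⟨l - 1, Nat.sub_lt hl one_pos⟩) • ε i = -ε i.rev := by
  obtain ⟨n, rfl⟩ := Nat.exists_eq_add_one.2 hl
  rw [omega, mul_smul, h.longestElement_smul he, smul_neg]
  exact congrArg Neg.neg (h.longestElement_sdiff_last_smul he i)

end IsFrame

end WeylC

/-! ### Mirror tuples -/

section Mirror

variable {q : ℕ} {κ : Type*}

/-- The avoiding tuples indexed by two copies of `κ` whose entries at corresponding places add up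
to `q`: up to the shift by `q`, they are fixed by exchanging the copies and changing all signs. -/
def mirrorTuples (q : ℕ) (κ : Type*) : Set (κ ⊕ κ → ZMod (2 * q)) :=
  {f | f ∈ avoidingTuples q 1 (κ ⊕ κ) ∧ ∀ i, f i + f i.swap = q}

lemma two_mul_eq_zero_iff {u : ZMod (2 * q)} : 2 * u = 0 ↔ u = 0 ∨ u = q := by
  obtain ⟨a, rfl⟩ := ZMod.intCast_surjective u
  refine ⟨fun h => ?_, ?_⟩
  · rw [← Int.cast_two, ← Int.cast_mul, ZMod.intCast_zmod_eq_zero_iff_dvd, Nat.cast_mul,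
      Nat.cast_two] at h
    obtain ⟨t, rfl⟩ := Int.dvd_of_mul_dvd_mul_left two_ne_zero h
    exact (Int.even_or_odd t).imp (fun ht => intCast_eq_zero_iff_exists_even.2 ⟨t, ht, rfl⟩)
      fun ht => intCast_eq_natCast_iff_exists_odd.2 ⟨t, ht, rfl⟩
  · rintro (h | h) <;> rw [h]
    · exact mul_zero 2
    · exact (two_mul _).trans natCast_self_add_self

lemma avoidsRoots_two_iff {g : κ → ZMod (2 * q)} : AvoidsRoots q 2 g ↔
    (∀ i, 2 * g i ≠ 0 ∧ 2 * g i ≠ q) ∧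
      ∀ i j, i ≠ j → (g i + g j ≠ 0 ∧ g i + g j ≠ q) ∧ (g i - g j ≠ 0 ∧ g i - g j ≠ q) := by
  simp only [AvoidsRoots, Nat.cast_ofNat, ne_eq, two_mul_eq_zero_iff (q := q), not_or]

lemma avoidsRoots_one_sumElim_iff [NeZero q] {g : κ → ZMod (2 * q)} :
    AvoidsRoots q 1 (Sum.elim g fun i => q - g i) ↔ AvoidsRoots q 2 g := by
  have hq := natCast_self_add_self (q := q)
  rw [avoidsRoots_two_iff]
  simp only [AvoidsRoots, Nat.cast_one, one_mul]
  constructor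
  · rintro ⟨hlong, hshort⟩
    refine ⟨fun i => ⟨hlong (.inl i), fun h => ?_⟩, fun i j hij => ?_⟩
    · exact (hshort (.inl i) (.inr i) Sum.inl_ne_inr).2 (by
        simp only [Sum.elim_inl, Sum.elim_inr]
        linear_combination h)
    · have hsame := hshort (.inl i) (.inl j) (Sum.inl_injective.ne hij)
      have hcross := hshort (.inl i) (.inr j) Sum.inl_ne_inr
      simp only [Sum.elim_inl, Sum.elim_inr] at hsame hcross
      exact ⟨⟨hsame.1, fun h => hcross.2 (by linear_combination h)⟩,
        hsame.2, fun h => hcross.1 (by linear_combination h + hq)⟩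
  · rintro ⟨hlong, hshort⟩
    refine ⟨?_, ?_⟩
    · rintro (i | i) h <;> simp only [Sum.elim_inl, Sum.elim_inr] at h
      · exact (hlong i).1 h
      · exact (hlong i).1 (by linear_combination hq - h)
    · rintro (i | i) (j | j) hij <;> simp only [Sum.elim_inl, Sum.elim_inr]
      · obtain ⟨hadd, hsub⟩ := hshort i j (by simpa using hij)
        exact ⟨hadd.1, hsub.1⟩
      · rcases eq_or_ne i j with rfl | hij
        · exact ⟨fun h => natCast_self_ne_zero (q := q) (by linear_combination h),
            fun h => (hlong i).2 (by linear_combination h)⟩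
        · obtain ⟨hadd, hsub⟩ := hshort i j hij
          exact ⟨fun h => hsub.2 (by linear_combination h - hq),
            fun h => hadd.2 (by linear_combination h)⟩
      · rcases eq_or_ne i j with rfl | hij
        · exact ⟨fun h => natCast_self_ne_zero (q := q) (by linear_combination h),
            fun h => (hlong i).2 (by linear_combination -h)⟩
        · obtain ⟨hadd, hsub⟩ := hshort i j hij
          exact ⟨fun h => hsub.2 (by linear_combination -h),
            fun h => hadd.2 (by linear_combination -h)⟩
      · obtain ⟨hadd, hsub⟩ := hshort i j (by simpa using hij)
        exact ⟨fun h => hadd.1 (by linear_combination hq - h),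
          fun h => hsub.1 (by linear_combination -h)⟩

lemma natCard_mirrorTuples_of_even [NeZero q] (hq : Even q) :
    Nat.card (mirrorTuples q κ) = Nat.card (avoidingTuples q 2 κ) := by
  have hpq : parity q q = 0 := by
    rw [map_natCast, ZMod.natCast_eq_zero_iff_even.2 hq]
  have hmem : ∀ g : κ → ZMod (2 * q), Sum.elim g (fun i => q - g i) ∈ avoidingTuples q 1 (κ ⊕ κ) ↔
      g ∈ avoidingTuples q 2 κ := fun g => by
    refine and_congr ?_ avoidsRoots_one_sumElim_iff
    simp [Sum.forall, hpq]
  have helim : ∀ f ∈ mirrorTuples q κ,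
      Sum.elim (fun i => f (.inl i)) (fun i => q - f (.inl i)) = f := fun f hf => by
    rw [← Sum.elim_comp_inl_inr f]
    exact congrArg _ (funext fun i => sub_eq_of_eq_add' (hf.2 (.inl i)).symm)
  refine Nat.card_congr ⟨fun f => ⟨fun i => f.1 (.inl i), (hmem _).1 ?_⟩,
    fun g => ⟨Sum.elim g.1 fun i => q - g.1 i, (hmem _).2 g.2, ?_⟩,
    fun f => Subtype.ext (helim f f.2), fun g => rfl⟩
  · rw [helim f f.2]
    exact f.2.1
  · rintro (i | i) <;> simp

lemma natCard_mirrorTuples_of_odd [Nonempty κ] (hq : Odd q) : Nat.card (mirrorTuples q κ) = 0 := by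
  have : IsEmpty (mirrorTuples q κ) := ⟨fun ⟨f, hf, hmirror⟩ => by
    obtain ⟨i⟩ := ‹Nonempty κ›
    have hsum := congrArg (parity q) (hmirror (.inl i))
    rw [map_add, hf.1 (.inl i) (Sum.swap (.inl i)), CharTwo.add_self_eq_zero, map_natCast,
      ZMod.natCast_eq_one_iff_odd.2 hq] at hsum
    exact zero_ne_one hsum⟩
  exact Nat.card_of_isEmpty

end Mirror

/-! ### Folding -/

section Average

variable {ι E : Type*} [NormedAddCommGroup E] [InnerProductSpace ℝ E]
  {P : RootPairing ι ℝ E E} {w : P.weylGroup}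

lemma smul_average (x : E) : w • average w x = average w x := by
  have hshift := (Finset.sum_range_succ' (fun t => w ^ (1 + t) • x) (orderOf w)).symm.trans
    (Finset.sum_range_succ _ _)
  rw [add_zero, pow_add w 1 (orderOf w), pow_orderOf_eq_one, mul_one, add_left_inj] at hshift
  rw [average, smul_comm, Finset.smul_sum, ← Finset.Ico_add_one_right_eq_Icc,
    Finset.sum_Ico_eq_sum_range, Finset.sum_Ico_eq_sum_range, Nat.add_sub_cancel, ← hshift]
  simp only [smul_smul, ← pow_succ', add_assoc]

/-- The averaging map `x ↦ x ^ w`, as a linear map to the fixed space. -/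
def averageHom (w : P.weylGroup) : E →ₗ[ℝ] fixedSpace w where
  toFun x := ⟨average w x, smul_average x⟩
  map_add' x y := Subtype.ext (by
    simp only [average, smul_add, Finset.sum_add_distrib, Submodule.coe_add])
  map_smul' a x := Subtype.ext (by
    simp only [average, smul_comm _ a, ← Finset.smul_sum, RingHom.id_apply, Submodule.coe_smul])

lemma averageHom_surjective (hw : IsOfFinOrder w) : Function.Surjective (averageHom w) := by
  intro x
  have hpow : ∀ t : ℕ, w ^ t • (x : E) = x := fun t => by
    induction t with
    | zero => rw [pow_zero, one_smul]
    | succ t ih => rw [pow_succ, mul_smul, show w • (x : E) = x from x.2, ih]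
  refine ⟨x, Subtype.ext ?_⟩
  change average w x = x
  rw [average, Finset.sum_congr rfl fun t _ => hpow t, Finset.sum_const, Nat.card_Icc,
    Nat.add_sub_cancel, ← Nat.cast_smul_eq_nsmul ℝ, smul_smul,
    inv_mul_cancel₀ (Nat.cast_ne_zero.2 hw.orderOf_pos.ne'), one_smul]

lemma average_of_orderOf_eq_two (hw : orderOf w = 2) (x : E) :
    average w x = (1 / 2 : ℝ) • (x + w • x) := by
  rw [average, hw, show Finset.Icc 1 2 = {1, 2} from rfl, Finset.sum_pair (by norm_num), pow_one,
    ← hw, pow_orderOf_eq_one, one_smul, hw, add_comm, one_div, Nat.cast_two]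

lemma equivChar_one [IsEuclidean P] (q : ℕ) :
    equivChar P q 1 = charQuasi (Set.range P.root) (latticeZ P) q := by
  rw [equivChar, MulAction.fixedBy_one_eq_univ, Nat.card_univ, charQuasi]

end Average

section SignedMap

variable {V V' κ κ' : Type*} [NormedAddCommGroup V] [NormedAddCommGroup V'] {ε : κ → V}

lemma signed_map {F : Type*} [FunLike F V V'] [AddMonoidHomClass F V V'] (f : F) :
    signed (f ∘ ε) = f '' signed ε := by
  ext v
  constructor
  · rintro ⟨i, rfl | rfl⟩
    · exact ⟨_, ⟨i, .inl rfl⟩, rfl⟩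
    · exact ⟨_, ⟨i, .inr rfl⟩, map_neg f _⟩
  · rintro ⟨_, ⟨i, rfl | rfl⟩, rfl⟩
    · exact ⟨i, .inl rfl⟩
    · exact ⟨i, .inr (map_neg f _)⟩

lemma frameRoots_map {F : Type*} [FunLike F V V'] [AddMonoidHomClass F V V'] (f : F) :
    frameRoots (f ∘ ε) = f '' frameRoots ε \ {0} := by
  ext v
  rw [frameRoots, signed_map]
  constructor
  · rintro ⟨hv, _, ⟨a, ha, rfl⟩, _, ⟨b, hb, rfl⟩, rfl⟩
    rw [← map_add] at hv ⊢
    exact ⟨⟨_, ⟨fun h0 => hv (by rw [h0, map_zero]), a, ha, b, hb, rfl⟩, rfl⟩, hv⟩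
  · rintro ⟨⟨_, ⟨-, a, ha, b, hb, rfl⟩, rfl⟩, hv⟩
    exact ⟨hv, _, ⟨a, ha, rfl⟩, _, ⟨b, hb, rfl⟩, map_add f a b⟩

lemma signed_comp_equiv (e : κ' ≃ κ) : signed (ε ∘ e) = signed ε :=
  Set.ext fun v => (e.surjective.exists (p := fun i => v = ε i ∨ v = -ε i)).symm

lemma frameRoots_comp_equiv (e : κ' ≃ κ) : frameRoots (ε ∘ e) = frameRoots ε := by
  rw [frameRoots, signed_comp_equiv, frameRoots]

lemma IsFrame.comp_equiv [InnerProductSpace ℝ V] {c : ℝ} (h : IsFrame ε c) (e : κ' ≃ κ) :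
    IsFrame (ε ∘ e) c where
  pos := h.pos
  inner_self i := h.inner_self (e i)
  orthogonal hij := h.orthogonal (e.injective.ne hij)
  span_eq_top := by rw [e.surjective.range_comp, h.span_eq_top]

end SignedMap

section Folding

variable {ι E κ : Type*} [NormedAddCommGroup E] [InnerProductSpace ℝ E]
  {P : RootPairing ι ℝ E E} {ω : P.weylGroup} {ε : κ ⊕ κ → E} {c : ℝ}

/-- The images of the first half of a family indexed by two copies of `κ` in the fixed space. -/
def foldedFrame (ω : P.weylGroup) (ε : κ ⊕ κ → E) : κ → fixedSpace ω := averageHom ω ∘ ε ∘ .inl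

variable (hω : ∀ i, ω • ε i = -ε i.swap)

include hω

lemma IsFrame.orderOf_eq_two [Nonempty κ] (h : IsFrame ε c) : orderOf ω = 2 := by
  obtain ⟨i⟩ := ‹Nonempty κ›
  have hmul : ω * ω = 1 := weylGroup_ext fun x => LinearMap.congr_fun
    (LinearMap.ext_on_range (f := DistribSMul.toLinearMap ℝ E (ω * ω))
      (g := DistribSMul.toLinearMap ℝ E (1 : P.weylGroup)) h.span_eq_top fun i => by
        simp only [DistribSMul.toLinearMap_apply, mul_smul, hω, smul_neg, neg_neg, Sum.swap_swap,
          one_smul]) x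
  refine orderOf_eq_prime ((pow_two ω).trans hmul) fun hone => h.pos.ne' ?_
  have hneg := hω (.inl i)
  rw [hone, one_smul, Sum.swap_inl] at hneg
  rw [← h.inner_self (.inl i)]
  nth_rw 2 [hneg]
  rw [inner_neg_right, h.orthogonal Sum.inl_ne_inr, neg_zero]

lemma averageHom_swap (hω2 : orderOf ω = 2) (i : κ ⊕ κ) :
    averageHom ω (ε i.swap) = -averageHom ω (ε i) := by
  refine Subtype.ext ?_
  change average ω (ε i.swap) = -average ω (ε i)
  rw [average_of_orderOf_eq_two hω2, average_of_orderOf_eq_two hω2, hω, hω, Sum.swap_swap]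
  module

lemma coe_foldedFrame (hω2 : orderOf ω = 2) (i : κ) :
    (foldedFrame ω ε i : E) = (1 / 2 : ℝ) • (ε (.inl i) - ε (.inr i)) :=
  (average_of_orderOf_eq_two hω2 _).trans (by
    rw [Function.comp_apply, hω, ← sub_eq_add_neg, Sum.swap_inl])

lemma signed_foldedFrame (hω2 : orderOf ω = 2) :
    signed (foldedFrame ω ε) = signed (averageHom ω ∘ ε) := by
  ext v
  simp only [signed, Set.mem_ofPred_eq, Sum.exists, foldedFrame, Function.comp_apply,
    ← Sum.swap_inl, averageHom_swap hω hω2, neg_neg]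
  exact (or_iff_left_of_imp fun ⟨i, hi⟩ => ⟨i, hi.symm⟩).symm

lemma frameRoots_foldedFrame (hω2 : orderOf ω = 2) (hP : Set.range P.root = frameRoots ε) :
    frameRoots (foldedFrame ω ε) = foldedRoots P ω := by
  rw [frameRoots, signed_foldedFrame hω hω2, ← frameRoots, frameRoots_map, ← hP, ← Set.range_comp]
  ext v
  exact and_comm.trans (and_congr_right fun _ => exists_congr fun i => Subtype.ext_iff)

lemma IsFrame.foldedFrame [Nonempty κ] (h : IsFrame ε c) :
    IsFrame (foldedFrame ω ε) (c / 2) where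
  pos := half_pos h.pos
  inner_self i := by
    rw [Submodule.coe_inner, coe_foldedFrame hω (h.orderOf_eq_two hω)]
    simp only [inner_smul_left, inner_smul_right, inner_sub_left, inner_sub_right,
      RCLike.conj_to_real, h.inner_self, h.orthogonal Sum.inl_ne_inr, h.orthogonal Sum.inr_ne_inl]
    ring
  orthogonal {i j} hij := by
    rw [Submodule.coe_inner, coe_foldedFrame hω (h.orderOf_eq_two hω),
      coe_foldedFrame hω (h.orderOf_eq_two hω)]
    simp only [inner_smul_left, inner_smul_right, inner_sub_left, inner_sub_right,
      h.orthogonal Sum.inl_ne_inr, h.orthogonal Sum.inr_ne_inl,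
      h.orthogonal (Sum.inl_injective.ne hij), h.orthogonal (Sum.inr_injective.ne hij), sub_zero,
      mul_zero]
  span_eq_top := by
    have hω2 := h.orderOf_eq_two hω
    have hsurj := averageHom_surjective (orderOf_pos_iff.1 (hω2 ▸ two_pos))
    rw [eq_top_iff, ← LinearMap.range_eq_top.2 hsurj, ← Submodule.map_top, ← h.span_eq_top,
      Submodule.map_span_le]
    rintro _ ⟨i | i, rfl⟩
    · exact Submodule.subset_span ⟨i, rfl⟩
    · rw [← Sum.swap_inl, averageHom_swap hω hω2]
      exact neg_mem (Submodule.subset_span ⟨i, rfl⟩)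

end Folding

section MirrorClasses

variable {ι E κ : Type*} [NormedAddCommGroup E] [InnerProductSpace ℝ E]
  {P : RootPairing ι ℝ E E} [IsEuclidean P] {ω : P.weylGroup} {ε : κ ⊕ κ → E} {c : ℝ} {q : ℕ}
  (hω : ∀ i, ω • ε i = -ε i.swap)

include hω

lemma HasCoords.weyl_smul {x : E} {y : κ ⊕ κ → ℤ} (hx : HasCoords ε x y) :
    HasCoords ε (ω • x) fun i => -y i.swap := fun i => by
  have hi : ε i = ω • -ε i.swap := by rw [smul_neg, hω, neg_neg, Sum.swap_swap]
  rw [hi, inner_weyl_smul, inner_neg_left, mul_neg, hx, Int.cast_neg]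

lemma IsFrame.mk_mem_modComplement_and_mk_eq_iff [Finite κ] (h : IsFrame ε c) {Φ : Set E}
    (hΦ : Φ = frameRoots ε) {x x' : coweightLattice Φ} {y : κ ⊕ κ → ℤ} (hx : HasCoords ε x y)
    (hx' : (x' : E) = ω • (x : E)) :
    ((QuotientAddGroup.mk x : ModQ (coweightLattice Φ) q) ∈
        modComplement Φ (coweightLattice Φ) q ∧
      (QuotientAddGroup.mk x' : ModQ (coweightLattice Φ) q) = QuotientAddGroup.mk x) ↔
      (fun i => (y i : ZMod (2 * q))) ∈ mirrorTuples q κ := by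
  subst hΦ
  have hy' : HasCoords ε (x' : E) fun i => -y i.swap := hx' ▸ hx.weyl_smul hω
  have hmem := hx.mk_mem_modComplement_iff h (d := 1) (q := q)
  rw [Nat.cast_one, dilate_one] at hmem
  rw [hmem, h.mk_eq_mk_iff hy' hx]
  refine and_congr_right fun hf => ?_
  have hq := natCast_self_add_self (q := q)
  push_cast
  constructor
  · -- avoidance excludes `y i + y i.swap = 0`, so fixed classes involve the shift by `q`
    rintro (hmirror | hmirror) i
    · have hne : i ≠ i.swap := by rcases i with i | i <;> simp
      have havoid := (hf.2.2 i i.swap hne).1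
      rw [Nat.cast_one, one_mul] at havoid
      exact absurd (by linear_combination -hmirror i) havoid
    · linear_combination -hq - hmirror i
  · exact fun hmirror => .inr fun i => by linear_combination -hq - hmirror i

lemma IsFrame.two_mul_equivChar [Finite κ] [Nonempty κ] [NeZero q] (h : IsFrame ε c)
    (hP : Set.range P.root = frameRoots ε) : 2 * equivChar P q ω = Nat.card (mirrorTuples q κ) := by
  have hcount : ∀ {Φ : Set E} (_ : Φ = frameRoots ε) {S : Set (ModQ (coweightLattice Φ) q)},
      (∀ (x : coweightLattice Φ) (y : κ ⊕ κ → ℤ), HasCoords ε x y →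
        (QuotientAddGroup.mk x ∈ S ↔ (fun i => (y i : ZMod (2 * q))) ∈ mirrorTuples q κ)) →
      2 * Nat.card S = Nat.card (mirrorTuples q κ) := by
    rintro _ rfl S hS
    exact h.two_mul_natCard_classes (fun f hf => hf.1.1) hS
  rw [equivChar, ← Nat.card_image_of_injective Subtype.val_injective]
  refine hcount hP fun x y hx => ?_
  rw [← h.mk_mem_modComplement_and_mk_eq_iff hω hP (x' := weylHom P ω x) hx rfl, ← smul_mk]
  constructor
  · rintro ⟨t, ht, hxt⟩
    rw [← hxt]
    exact ⟨t.2, congrArg Subtype.val ht⟩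
  · rintro ⟨hmem, hfixed⟩
    exact ⟨⟨_, hmem⟩, Subtype.ext hfixed, rfl⟩

lemma IsFrame.equivChar_of_odd [Finite κ] [Nonempty κ] (h : IsFrame ε c)
    (hP : Set.range P.root = frameRoots ε) (hq : Odd q) : equivChar P q ω = 0 := by
  have : NeZero q := ⟨hq.pos.ne'⟩
  have htwo := h.two_mul_equivChar (q := q) hω hP
  rw [natCard_mirrorTuples_of_odd hq] at htwo
  lia

theorem IsFrame.equivChar_of_even [Finite κ] [Nonempty κ] (h : IsFrame ε c)
    (hP : Set.range P.root = frameRoots ε) (hq0 : 0 < q) (hq : Even q) :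
    equivChar P q ω =
      charQuasi (dilate 2 (foldedRoots P ω)) (coweightLattice (foldedRoots P ω)) q := by
  have : NeZero q := ⟨hq0.ne'⟩
  have htwo := (h.foldedFrame hω).two_mul_charQuasi (q := q) 2
  rw [← natCard_mirrorTuples_of_even hq, ← h.two_mul_equivChar hω hP, Nat.cast_two,
    frameRoots_foldedFrame hω (h.orderOf_eq_two hω) hP] at htwo
  exact (mul_left_cancel₀ two_ne_zero htwo).symm

end MirrorClasses

section Values

variable {ι E κ : Type*} [NormedAddCommGroup E] [InnerProductSpace ℝ E]
  {P : RootPairing ι ℝ E E} [IsEuclidean P] {q : ℕ}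

section Identity

variable {ε : κ → E} {c : ℝ} [Finite κ] [Nonempty κ]

lemma IsFrame.equivChar_one_of_odd (h : IsFrame ε c) (hP : Set.range P.root = frameRoots ε)
    (hq : Odd q) :
    (equivChar P q 1 : ℤ) = ∏ k ∈ Finset.Icc 1 (Nat.card κ), ((q : ℤ) - (2 * k - 1)) := by
  have hcount := h.charQuasi_of_odd (one_mul q).symm one_pos hq
  rw [Nat.cast_one, dilate_one, ← hP] at hcount
  simpa only [equivChar_one, latticeZ, Nat.cast_one, one_mul] using hcount

lemma IsFrame.equivChar_one_of_even (h : IsFrame ε c) (hP : Set.range P.root = frameRoots ε)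
    (hq0 : 0 < q) (hq : Even q) :
    (equivChar P q 1 : ℤ) =
      (∏ k ∈ Finset.Icc 1 (Nat.card κ - 1), ((q : ℤ) - 2 * k)) * (q - Nat.card κ) := by
  have hcount := h.charQuasi_of_even (one_mul q).symm hq0 hq
  rw [Nat.cast_one, dilate_one, ← hP] at hcount
  simpa only [equivChar_one, latticeZ, Nat.cast_one, one_mul, mul_one] using hcount

end Identity

lemma odd_of_gcd_four_eq_one (hq : Nat.gcd 4 q = 1) : Odd q :=
  Nat.coprime_two_left.1 (Nat.Coprime.coprime_dvd_left (by norm_num) hq)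

lemma exists_odd_of_gcd_four_eq_two (hq : Nat.gcd 4 q = 2) : ∃ s, q = 2 * s ∧ Odd s := by
  obtain ⟨s, rfl⟩ : 2 ∣ q := hq ▸ Nat.gcd_dvd_right 4 q
  rw [show 4 = 2 * 2 from rfl, Nat.gcd_mul_left] at hq
  exact ⟨s, rfl, Nat.coprime_two_left.1 (Nat.eq_of_mul_eq_mul_left two_pos hq)⟩

lemma exists_even_of_gcd_four_eq_four (hq : Nat.gcd 4 q = 4) : ∃ s, q = 2 * s ∧ Even s := by
  obtain ⟨s, rfl⟩ := Nat.gcd_eq_left_iff_dvd.1 hq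
  exact ⟨2 * s, by ring, even_two_mul s⟩

variable [Finite κ] [Nonempty κ] {ω : P.weylGroup} {ε : κ ⊕ κ → E} {c : ℝ}
  (hω : ∀ i, ω • ε i = -ε i.swap)

include hω

lemma IsFrame.equivChar_of_gcd_four_eq_two (h : IsFrame ε c)
    (hP : Set.range P.root = frameRoots ε) (hq : Nat.gcd 4 q = 2) :
    (equivChar P q ω : ℤ) = ∏ k ∈ Finset.Icc 1 (Nat.card κ), ((q : ℤ) - (4 * k - 2)) := by
  obtain ⟨s, hqs, hs⟩ := exists_odd_of_gcd_four_eq_two hq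
  rw [h.equivChar_of_even hω hP (hqs ▸ Nat.mul_pos two_pos hs.pos) (hqs ▸ even_two_mul s),
    ← frameRoots_foldedFrame hω (h.orderOf_eq_two hω) hP, ← Nat.cast_two,
    (h.foldedFrame hω).charQuasi_of_odd hqs two_pos hs]
  exact Finset.prod_congr rfl fun k _ => by push_cast; ring

lemma IsFrame.equivChar_of_gcd_four_eq_four (h : IsFrame ε c)
    (hP : Set.range P.root = frameRoots ε) (hq0 : 0 < q) (hq : Nat.gcd 4 q = 4) :
    (equivChar P q ω : ℤ) =
      (∏ k ∈ Finset.Icc 1 (Nat.card κ - 1), ((q : ℤ) - 4 * k)) * (q - 2 * Nat.card κ) := by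
  obtain ⟨s, hqs, hs⟩ := exists_even_of_gcd_four_eq_four hq
  rw [h.equivChar_of_even hω hP hq0 (hqs ▸ even_two_mul s),
    ← frameRoots_foldedFrame hω (h.orderOf_eq_two hω) hP, ← Nat.cast_two,
    (h.foldedFrame hω).charQuasi_of_even hqs hq0 hs]
  norm_num

lemma IsFrame.equivChar_eq_totient_mul_charQuasi (h : IsFrame ε c)
    (hP : Set.range P.root = frameRoots ε) (hq0 : 0 < q) :
    equivChar P q ω =
      (if orderOf ω ∣ q then Nat.totient (orderOf ω) else 0) *
        charQuasi (dilate 2 (foldedRoots P ω)) (coweightLattice (foldedRoots P ω)) q := by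
  rw [h.orderOf_eq_two hω]
  split_ifs with hq
  · rw [Nat.totient_two, one_mul, h.equivChar_of_even hω hP hq0 (even_iff_two_dvd.2 hq)]
  · rw [zero_mul, h.equivChar_of_odd hω hP (Nat.not_even_iff_odd.1 fun hq2 => hq hq2.two_dvd)]

end Values

/-- The labelling of `Fin (r + r)` by two copies of `Fin r` under which exchanging the copies
becomes the reversal of `Fin (r + r)`. -/
def mirrorEquiv (r : ℕ) : Fin r ⊕ Fin r ≃ Fin (r + r) :=
  (Equiv.sumCongr (.refl _) Fin.revPerm).trans finSumFinEquiv

lemma mirrorEquiv_swap {r : ℕ} (i : Fin r ⊕ Fin r) :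
    mirrorEquiv r i.swap = (mirrorEquiv r i).rev := by
  rcases i with i | i <;> ext <;>
    simp only [mirrorEquiv, Equiv.trans_apply, Equiv.sumCongr_apply, Sum.swap_inl, Sum.swap_inr,
      Sum.map_inl, Sum.map_inr, finSumFinEquiv_apply_left, finSumFinEquiv_apply_right,
      Fin.revPerm_apply, Equiv.refl_apply, Fin.val_rev, Fin.val_natAdd, Fin.val_castAdd] <;> lia

end EquivQuasi

end

theorem mainTheorem8 {ι E : Type*} [NormedAddCommGroup E] [InnerProductSpace ℝ E]
    [FiniteDimensional ℝ E] [Finite ι]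
    (P : RootPairing ι ℝ E E) [EquivQuasi.IsEuclidean P] [P.IsRootSystem] [P.IsReduced]
    [P.IsCrystallographic]
    (b : P.Base) (l : ℕ) (hl : Even l) (hl0 : 0 < l)
    (e : Fin l ≃ b.support) (he : EquivQuasi.IsTypeCLabelling b e)
    (ω : P.weylGroup) (hω : ω = EquivQuasi.omega b (e ⟨l - 1, Nat.sub_lt hl0 one_pos⟩)) :
    -- the values at the identity
    (∀ q : ℕ, 0 < q → Odd q →
      (EquivQuasi.equivChar P q 1 : ℤ) = ∏ k ∈ Finset.Icc 1 l, ((q : ℤ) - (2 * (k : ℤ) - 1))) ∧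
    (∀ q : ℕ, 0 < q → Even q →
      (EquivQuasi.equivChar P q 1 : ℤ) =
        (∏ k ∈ Finset.Icc 1 (l - 1), ((q : ℤ) - 2 * (k : ℤ))) * ((q : ℤ) - (l : ℤ))) ∧
    -- the values at `ω_l`
    (∀ q : ℕ, 0 < q → Nat.gcd 4 q = 1 → EquivQuasi.equivChar P q ω = 0) ∧
    (∀ q : ℕ, 0 < q → Nat.gcd 4 q = 2 →
      (EquivQuasi.equivChar P q ω : ℤ) =
        ∏ k ∈ Finset.Icc 1 (l / 2), ((q : ℤ) - (4 * (k : ℤ) - 2))) ∧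
    (∀ q : ℕ, 0 < q → Nat.gcd 4 q = 4 →
      (EquivQuasi.equivChar P q ω : ℤ) =
        (∏ k ∈ Finset.Icc 1 (l / 2 - 1), ((q : ℤ) - 4 * (k : ℤ))) * ((q : ℤ) - (l : ℤ))) ∧
    -- the description by folding to type `C_{l/2}` with dilation `2`
    orderOf ω = 2 ∧
    EquivQuasi.IsRootSystemOfTypeC (l / 2) (EquivQuasi.foldedRoots P ω) ∧
    (∀ q : ℕ, 0 < q →
      EquivQuasi.equivChar P q ω =
        (if orderOf ω ∣ q then Nat.totient (orderOf ω) else 0) *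
          EquivQuasi.charQuasi (EquivQuasi.dilate 2 (EquivQuasi.foldedRoots P ω))
            (EquivQuasi.coweightLattice (EquivQuasi.foldedRoots P ω)) q) := by
  obtain ⟨ε, c, h, hroot⟩ := EquivQuasi.exists_isFrame he
  obtain ⟨r, rfl⟩ := hl
  have : Nonempty (Fin r) := ⟨0, by lia⟩
  have : Nonempty (Fin (r + r)) := ⟨0, hl0⟩
  have hP := h.range_root_eq hroot
  have hδ := h.comp_equiv (EquivQuasi.mirrorEquiv r)
  have hPδ := hP.trans (EquivQuasi.frameRoots_comp_equiv (EquivQuasi.mirrorEquiv r)).symm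
  have hωδ : ∀ i, ω • (ε ∘ EquivQuasi.mirrorEquiv r) i = -(ε ∘ EquivQuasi.mirrorEquiv r) i.swap :=
    fun i => by
      rw [hω, Function.comp_apply, Function.comp_apply, h.omega_smul hroot hl0,
        EquivQuasi.mirrorEquiv_swap]
  have hcard : Nat.card (Fin r) = (r + r) / 2 := by rw [Nat.card_fin]; lia
  refine ⟨fun q _ hq => ?_, fun q hq0 hq => ?_, fun q _ hq => ?_, fun q _ hq => ?_,
    fun q hq0 hq => ?_, hδ.orderOf_eq_two hωδ, ?_, fun q hq0 => ?_⟩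
  · rw [h.equivChar_one_of_odd hP hq, Nat.card_fin]
  · rw [h.equivChar_one_of_even hP hq0 hq, Nat.card_fin]
  · exact hδ.equivChar_of_odd hωδ hPδ (EquivQuasi.odd_of_gcd_four_eq_one hq)
  · rw [hδ.equivChar_of_gcd_four_eq_two hωδ hPδ hq, hcard]
  · rw [hδ.equivChar_of_gcd_four_eq_four hωδ hPδ hq0 hq, hcard, ← Nat.cast_two (R := ℤ),
      ← Nat.cast_mul, Nat.two_mul_div_two_of_even ⟨r, rfl⟩]
  · rw [← hcard, Nat.card_fin, ← EquivQuasi.frameRoots_foldedFrame hωδ (hδ.orderOf_eq_two hωδ) hPδ]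
    exact (hδ.foldedFrame hωδ).isRootSystemOfTypeC
  · exact hδ.equivChar_eq_totient_mul_charQuasi hωδ hPδ hq0
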